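/- Let $r=n/q$ be a rational function, $n,q\in\mathbb C[z]$ coprime, $n$ non-constant, $N=\deg n\ge\deg q$. Let $D_w$ be pairwise disjoint open disks, one around each distinct zero $w$ of $r$, whose closures contain no pole of $r$; put $\rho=\min|r|$ over the union of the circles $\partial D_w$ and assume $\{z:|r(z)|<\rho\}\subset\bigcup_w D_w$. Let $$A(r)=\mathbb C\setminus\bigcup_w r(\partial D_w),$$ let $r^{-1}(A(r))$ be the set of points $z$, not poles of $r$, with $r(z)\in A(r)$, and let $\Omega(r)$ be the set of $v\in\mathbb C$ for which $r(z)=v$ has $N$ pairwise different roots. Let $\mathfrak L(r)$ be the linear span of the functions $z\mapsto\frac{r(z)-r(a)}{z-a}$, $a$ running through the points of analyticity of $r$, and let $Z_r=(e_1,\dots,e_N)$, where $e_1,\dots,e_N$ is a basis of $\mathfrak L(r)$. Let $\mathfrak P$ be a reproducing kernel Pontryagin space, with kernel $K$, of $\mathbb C^p$-valued functions analytic in $r^{-1}(A(r))$. For $\alpha\in\Omega(r)\cap A(r)$ let $a_1,\dots,a_N$ be the roots of $r(z)=\alpha$, and let $\mathbf K(\alpha)=\big(K(a_i,a_j)\big)_{i,j=1}^N\in\mathbb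 C^{Np\times Np}$. A signature matrix is a matrix $J$ with $J=J^*=J^{-1}$. **(Line case.)** Assume that for every non-real $v\in\Omega(r)\cap A(r)$ and all $f,g\in\mathfrak P$ vanishing at all the roots of $r(w)=v$, the functions $f\,\frac{r-\overline v}{r-v}$ and $g\,\frac{r-\overline v}{r-v}$ (extended analytically to the roots) belong to $\mathfrak P$, and $$[f,g]_{\mathfrak P}=\Big[f\,\tfrac{r-\overline v}{r-v},\;g\,\tfrac{r-\overline v}{r-v}\Big]_{\mathfrak P}.$$ Assume that $\mathfrak P$ has full rank: there is a non-real $\alpha$ such that $\alpha,\overline\alpha\in\Omega(r)$ lie in the same connected component of $A(r)$ (for instance $|\alpha|<\rho$) and $\mathbf K(\alpha)$ and $\mathbf K(\overline\alpha)$ are invertible. Then there are a signature matrix $J\in\mathbb C^{Np\times Np}$ with the same signature as $\mathbf K(\alpha)$, and $\mathbb C^{Np\times Np}$-valued functions $E_+,E_-$ on $A(r)$, analytic at every point of $A(r)$ different from $r(\infty)$, such that for all $z,w\in r^{-1}(A(r))$ $$K(z,w)=(Z_r(z)\otimes I_p)\,\frac{E_+(r(z))JE_+(r(w))^*-E_-(r(z))JE_-(r(w))^*}{-i\,(r(z)-\overline{r(w)})}\,(Z_r(w)\otimes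 I_p)^*,$$ understood after multiplication of both sides by the scalar denominator. **(Circle case.)** Assume instead that the same invariance and isometry hold with $\frac{1-r\,\overline v}{r-v}$ in place of $\frac{r-\overline v}{r-v}$, for every $v\in\Omega(r)\cap A(r)$ with $|v|\ne1$, and that $\mathfrak P$ has full rank: there is $\alpha\neq0$ with $|\alpha|\ne1$ such that $\alpha,1/\overline\alpha\in\Omega(r)$ lie in the same connected component of $A(r)$ and $\mathbf K(\alpha)$ and $\mathbf K(1/\overline\alpha)$ are invertible. Then the same conclusion holds with the denominator $1-r(z)\overline{r(w)}$ in place of $-i(r(z)-\overline{r(w)})$. -/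

import Mathlib

open scoped ComplexConjugate Matrix

noncomputable section

namespace RationalPontryagin

/-! ### Rational functions and their state space -/

/-- The value `r(z)` of a rational function; meaningful when `z` is not a pole of `r`. -/
def val (r : RatFunc ℂ) (z : ℂ) : ℂ := r.eval (RingHom.id ℂ) z

/-- `z` is not a pole of `r` (numerator and denominator in lowest terms). -/
def IsRegularAt (r : RatFunc ℂ) (z : ℂ) : Prop := r.denom.eval z ≠ 0

/-- The degree `N` of the numerator of `r`. -/
abbrev deg (r : RatFunc ℂ) : ℕ := r.num.natDegree

/-- `Ω(r)`: the values `v` for which `r(z) = v` has `N` pairwise different roots. -/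
def simpleValues (r : RatFunc ℂ) : Set ℂ :=
  {v | {z : ℂ | IsRegularAt r z ∧ val r z = v}.ncard = deg r}

/-- The state space `𝔏(r)`: the linear span of the rational functions
`z ↦ (r(z) - r(a)) / (z - a)`, where `a` runs through the points of analyticity of `r`. -/
def stateSpace (r : RatFunc ℂ) : Submodule ℂ (RatFunc ℂ) :=
  Submodule.span ℂ
    {g | ∃ a : ℂ, IsRegularAt r a ∧ g = (r - RatFunc.C (val r a)) / (RatFunc.X - RatFunc.C a)}

/-- The `p × Np` matrix `Z_r(z) ⊗ I_p`, where `Z_r = (e_1, …, e_N)`. -/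
def ZI {r : RatFunc ℂ} (e : Module.Basis (Fin (deg r)) ℂ (stateSpace r)) (p : ℕ) (z : ℂ) :
    Matrix (Fin p) (Fin (deg r) × Fin p) ℂ :=
  Matrix.of fun i x => val (e x.1 : RatFunc ℂ) z * (1 : Matrix (Fin p) (Fin p) ℂ) i x.2

/-! ### The disks around the zeros, and the set `A(r)` -/

/-- The union of the circles bounding the disks `D_w`, one for each zero `w` of `r`. -/
def circles (r : RatFunc ℂ) (c : ℂ → ℂ) (R : ℂ → ℝ) : Set ℂ :=
  ⋃ w ∈ {w : ℂ | r.num.IsRoot w}, Metric.sphere (c w) (R w)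

/-- `ρ`, the minimum of `|r|` on the circles. -/
def rho (r : RatFunc ℂ) (c : ℂ → ℂ) (R : ℂ → ℝ) : ℝ :=
  sInf ((fun s => ‖val r s‖) '' circles r c R)

/-- Pairwise disjoint open disks around the distinct zeros of `r`, whose closures contain no pole
of `r`, and such that `{z | |r(z)| < ρ}` is contained in the union of the disks. -/
structure DiskSystem (r : RatFunc ℂ) where
  center : ℂ → ℂ
  radius : ℂ → ℝ
  zero_mem : ∀ w, r.num.IsRoot w → w ∈ Metric.ball (center w) (radius w)
  disjoint : ∀ w w', r.num.IsRoot w → r.num.IsRoot w' → w ≠ w' →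
    Disjoint (Metric.ball (center w) (radius w)) (Metric.ball (center w') (radius w'))
  regular : ∀ w, r.num.IsRoot w → ∀ z ∈ Metric.closedBall (center w) (radius w), IsRegularAt r z
  sublevel : ∀ z, IsRegularAt r z → ‖val r z‖ < rho r center radius →
    ∃ w, r.num.IsRoot w ∧ z ∈ Metric.ball (center w) (radius w)

/-- `A(r)`, the complement of the images under `r` of the circles. -/
def DiskSystem.A {r : RatFunc ℂ} (D : DiskSystem r) : Set ℂ :=
  (val r '' circles r D.center D.radius)ᶜ

/-- `r⁻¹(A(r))`: the points `z`, not poles of `r`, with `r(z) ∈ A(r)`. -/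
def DiskSystem.domain {r : RatFunc ℂ} (D : DiskSystem r) : Set ℂ :=
  {z | IsRegularAt r z ∧ val r z ∈ D.A}

/-- `A(r)` without the value `r(∞)`: the equation `r(z) = u` has `N` finite roots, counted with
multiplicity. When `r(∞) = ∞` this is all of `A(r)`. -/
def DiskSystem.finiteA {r : RatFunc ℂ} (D : DiskSystem r) : Set ℂ :=
  {u ∈ D.A | (r.num - Polynomial.C u * r.denom).natDegree = deg r}

/-! ### Reproducing kernel Pontryagin spaces -/

/-- A Pontryagin space: a Hermitian form (linear in the first variable) for which the space is the
orthogonal direct sum of a Hilbert space and a finite-dimensional anti-Hilbert space. -/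
structure IsPontryagin {V : Type*} [AddCommGroup V] [Module ℂ V]
    (form : V →ₗ[ℂ] V →ₗ⋆[ℂ] ℂ) : Prop where
  hermitian : ∀ f g, form g f = conj (form f g)
  decomposition : ∃ Vp Vm : Submodule ℂ V, IsCompl Vp Vm ∧
    (∀ f ∈ Vp, ∀ g ∈ Vm, form f g = 0) ∧
    (∀ f ∈ Vp, f ≠ 0 → 0 < (form f f).re) ∧
    (∀ f ∈ Vm, f ≠ 0 → (form f f).re < 0) ∧
    FiniteDimensional ℂ Vm ∧
    ∀ u : ℕ → V, (∀ n, u n ∈ Vp) →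
      (∀ ε > 0, ∃ k, ∀ m ≥ k, ∀ n ≥ k, (form (u m - u n) (u m - u n)).re < ε) →
      ∃ f ∈ Vp, ∀ ε > 0, ∃ k, ∀ n ≥ k, (form (u n - f) (u n - f)).re < ε

/-- A reproducing kernel Pontryagin space of `ℂ^p`-valued functions on `S`: for all `w ∈ S` and
`c ∈ ℂ^p`, the function `K(·, w)c` belongs to the space and `[f, K(·, w)c] = c^* f(w)`. -/
structure RKPontryaginSpace (S : Set ℂ) (p : ℕ) where
  carrier : Submodule ℂ (S → Fin p → ℂ)
  form : carrier →ₗ[ℂ] carrier →ₗ⋆[ℂ] ℂ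
  isPontryagin : IsPontryagin form
  kernel : S → S → Matrix (Fin p) (Fin p) ℂ
  kernel_mem : ∀ (w : S) (c : Fin p → ℂ), (fun z => kernel z w *ᵥ c) ∈ carrier
  reproducing : ∀ (f : carrier) (w : S) (c : Fin p → ℂ),
    form f ⟨fun z => kernel z w *ᵥ c, kernel_mem w c⟩ = star c ⬝ᵥ f.1 w

/-- The elements of the space are analytic functions on the (open) set `S`. -/
def RKPontryaginSpace.IsAnalytic {S : Set ℂ} {p : ℕ} (P : RKPontryaginSpace S p) : Prop :=
  ∀ f ∈ P.carrier, ∃ F : ℂ → Fin p → ℂ, AnalyticOnNhd ℂ F S ∧ ∀ z : S, F z = f z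

section Multiplication

variable {r : RatFunc ℂ} {D : DiskSystem r} {p : ℕ}

/-- `f` vanishes at all the roots of `r(w) = v`. -/
def VanishesOver (P : RKPontryaginSpace D.domain p) (v : ℂ) (f : P.carrier) : Prop :=
  ∀ w : D.domain, val r w = v → f.1 w = 0

/-- `g(z) = f(z) m(r(z)) / (r(z) - v)` on `r⁻¹(A(r))`, written without division; at the roots of
`r(z) = v` the value of `g` is the one given by continuity when the elements of the space
are analytic. -/
def IsProduct (P : RKPontryaginSpace D.domain p) (m : ℂ → ℂ) (v : ℂ) (f g : P.carrier) : Prop :=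
  ∀ z : D.domain, (val r z - v) • g.1 z = m (val r z) • f.1 z

/-- Multiplication by `m(r(z)) / (r(z) - v)` maps the functions of the space that vanish at all the
roots of `r(w) = v` into the space, and preserves their inner products. -/
def IsIsometricMultiplier (P : RKPontryaginSpace D.domain p) (m : ℂ → ℂ) (v : ℂ) : Prop :=
  (∀ f, VanishesOver P v f → ∃ g, IsProduct P m v f g) ∧
  ∀ f₁ f₂ g₁ g₂, VanishesOver P v f₁ → VanishesOver P v f₂ →
    IsProduct P m v f₁ g₁ → IsProduct P m v f₂ g₂ → P.form f₁ f₂ = P.form g₁ g₂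

/-- The line case: multiplication by `(r(z) - conj v) / (r(z) - v)`, for nonreal
`v ∈ Ω(r) ∩ A(r)`. -/
def LineIsometric (P : RKPontryaginSpace D.domain p) : Prop :=
  ∀ v ∈ simpleValues r ∩ D.A, v ≠ conj v →
    IsIsometricMultiplier P (fun u => u - conj v) v

/-- The circle case: multiplication by `(1 - r(z) conj v) / (r(z) - v)`, for
`v ∈ Ω(r) ∩ A(r)` not on the unit circle. -/
def CircleIsometric (P : RKPontryaginSpace D.domain p) : Prop :=
  ∀ v ∈ simpleValues r ∩ D.A, ‖v‖ ≠ 1 →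
    IsIsometricMultiplier P (fun u => 1 - u * conj v) v

/-- `a_1, …, a_N` are the (pairwise different) roots of `r(z) = α`. -/
def IsFibre (α : ℂ) (a : Fin (deg r) → D.domain) : Prop :=
  Function.Injective a ∧ ∀ n, val r (a n) = α

/-- The `Np × Np` block matrix `(K(a_n, a_m))_{n,m}`. -/
def gram (P : RKPontryaginSpace D.domain p) (a : Fin (deg r) → D.domain) :
    Matrix (Fin (deg r) × Fin p) (Fin (deg r) × Fin p) ℂ :=
  Matrix.of fun x y => P.kernel (a x.1) (a y.1) x.2 y.2

end Multiplication

/-! ### Signatures -/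

/-- A signature matrix: `J = J^* = J⁻¹`. -/
def IsSignatureMatrix {n : Type*} [Fintype n] [DecidableEq n] (J : Matrix n n ℂ) : Prop :=
  Jᴴ = J ∧ J * J = 1

/-- Two Hermitian matrices have the same numbers of positive and of negative eigenvalues, counted
with multiplicity. -/
def SameSignature {n : Type*} [Fintype n] [DecidableEq n] (A B : Matrix n n ℂ) : Prop :=
  ∃ (hA : A.IsHermitian) (hB : B.IsHermitian),
    {i | 0 < hA.eigenvalues i}.ncard = {i | 0 < hB.eigenvalues i}.ncard ∧
    {i | hA.eigenvalues i < 0}.ncard = {i | hB.eigenvalues i < 0}.ncard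

/-- There are a signature matrix `J`, with the same signature as the Hermitian matrix `H`, and
matrix functions `E₊`, `E₋`, analytic in `A(r) \ {r(∞)}`, with
`d(r(z), r(w)) K(z, w) =
  (Z_r(z) ⊗ I_p) (E₊(r(z)) J E₊(r(w))^* - E₋(r(z)) J E₋(r(w))^*) (Z_r(w) ⊗ I_p)^*`. -/
def HasKernelForm {r : RatFunc ℂ} {D : DiskSystem r} {p : ℕ}
    (e : Module.Basis (Fin (deg r)) ℂ (stateSpace r)) (P : RKPontryaginSpace D.domain p)
    (d : ℂ → ℂ → ℂ) (H : Matrix (Fin (deg r) × Fin p) (Fin (deg r) × Fin p) ℂ) : Prop :=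
  ∃ (J : Matrix (Fin (deg r) × Fin p) (Fin (deg r) × Fin p) ℂ)
    (Ep Em : ℂ → Matrix (Fin (deg r) × Fin p) (Fin (deg r) × Fin p) ℂ),
    IsSignatureMatrix J ∧ SameSignature J H ∧
    (∀ i j, AnalyticOnNhd ℂ (fun u => Ep u i j) D.finiteA) ∧
    (∀ i j, AnalyticOnNhd ℂ (fun u => Em u i j) D.finiteA) ∧
    ∀ z w : D.domain,
      d (val r z) (val r w) • P.kernel z w =
        ZI e p z *
          (Ep (val r z) * J * (Ep (val r w))ᴴ - Em (val r z) * J * (Em (val r w))ᴴ) *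
          (ZI e p w)ᴴ

end RationalPontryagin

end

open RationalPontryagin

namespace RationalPontryagin
open Polynomial

noncomputable section

/-! ### Values of rational functions, and the pencil `n - u q` -/

/-! Write β for the reflection of α in the line or circle, and `a`, `b` for the fibres over α and β.
Subtracting K(z,a) **K**(α)⁻¹ K(a,w) from K leaves the reproducing kernel of the subspace of
functions vanishing on the fibre `a` (`reducedKernel`). The multiplier m(r)/(r - α) maps this
subspace isometrically onto the one belonging to β; its inverse is, up to a constant, the multiplier
at β. Comparing reproducing kernels gives `smul_reducedKernel`, in which the terms containing K(z,w)
collect to γ d(r(z), r(w)) K(z,w), with γ real and nonzero and d the required denominator.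

The other terms involve only the block rows K(z,a) and K(z,b). An analytic function on r⁻¹(A(r)) is
Z_r(z) G(r(z)) with G analytic off r(∞) (`exists_analytic_coefficients`). Locally this is division
with remainder by n - uq, carried out by a Cauchy integral (`exists_analyticAt_division`); the local
pieces agree because coefficients are unique at values without multiple roots. Hence γ d K = Z_r (A₁
**K**(α)⁻¹ A₁* - B₁ **K**(β)⁻¹ B₁*) Z_r*, with Z_r standing for Z_r ⊗ I_p and A₁, B₁ analytic in u =
r(z).

It remains to use one J for both terms. The component of A(r) containing α and β meets the line or
circle, where d(x,x) = 0. Since det A₁(α) ≠ 0, the identity theorem yields such an x, without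
multiple roots in its fibre, with A₁(x) invertible (`exists_ne_zero_mem`). There the two terms
balance, so **K**(β)⁻¹ = C **K**(α)⁻¹ C* with C = B₁(x)⁻¹A₁(x). Diagonalizing, **K**(α)⁻¹ = S J S*,
and E₊, E₋ are A₁S and B₁CS divided by √|γ|, interchanged when γ < 0. -/

theorem val_eq (r : RatFunc ℂ) (z : ℂ) : val r z = r.num.eval z / r.denom.eval z := by
  simp [val, RatFunc.eval, Polynomial.eval₂_id]

/-- The fraction need not be in lowest terms: the reduced denominator divides `q`, so it is nonzero
at `z` as well. -/
theorem val_div {p q : ℂ[X]} {z : ℂ} (hq : q.eval z ≠ 0) :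
    val (algebraMap ℂ[X] (RatFunc ℂ) p / algebraMap ℂ[X] (RatFunc ℂ) q) z =
      p.eval z / q.eval z := by
  have hq0 : q ≠ 0 := by rintro rfl; simp at hq
  rw [val_eq]
  set x := algebraMap ℂ[X] (RatFunc ℂ) p / algebraMap ℂ[X] (RatFunc ℂ) q with hx
  have hd : x.denom.eval z ≠ 0 := fun h0 =>
    hq (Polynomial.eval_eq_zero_of_dvd_of_eval_eq_zero (RatFunc.denom_div_dvd p q) h0)
  have h := congrArg (Polynomial.eval z) ((RatFunc.num_mul_eq_mul_denom_iff hq0).2 hx)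
  rw [eval_mul, eval_mul] at h
  rw [div_eq_div_iff hd hq, h]

/-- The polynomial `n - u q`, whose roots are the roots of `r = u`. -/
def pencil (r : RatFunc ℂ) (u : ℂ) : ℂ[X] := r.num - C u * r.denom

theorem eval_pencil (r : RatFunc ℂ) (u z : ℂ) :
    (pencil r u).eval z = r.num.eval z - u * r.denom.eval z := by simp [pencil]

theorem eval_num_ne_zero_of_eval_denom_eq_zero {r : RatFunc ℂ} {z : ℂ}
    (h : r.denom.eval z = 0) : r.num.eval z ≠ 0 := by
  obtain ⟨s, t, hst⟩ := r.isCoprime_num_denom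
  intro h'
  have := congrArg (Polynomial.eval z) hst
  simp [h, h'] at this

theorem eval_pencil_eq_zero_iff {r : RatFunc ℂ} {u z : ℂ} :
    (pencil r u).eval z = 0 ↔ IsRegularAt r z ∧ val r z = u := by
  rw [eval_pencil, IsRegularAt, val_eq]
  constructor
  · intro h
    have hz : r.denom.eval z ≠ 0 := fun h0 => by
      apply eval_num_ne_zero_of_eval_denom_eq_zero h0
      simpa [h0] using h
    exact ⟨hz, by rw [div_eq_iff hz]; linear_combination h⟩
  · rintro ⟨hz, h⟩
    rw [div_eq_iff hz] at h
    rw [h, sub_self]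

theorem natDegree_pencil_le {r : RatFunc ℂ} (hdeg : r.denom.natDegree ≤ r.num.natDegree) (u : ℂ) :
    (pencil r u).natDegree ≤ deg r :=
  (natDegree_sub_le _ _).trans (max_le le_rfl ((natDegree_C_mul_le _ _).trans hdeg))

theorem pencil_ne_zero {r : RatFunc ℂ} (hnum : 0 < r.num.natDegree) (u : ℂ) : pencil r u ≠ 0 := by
  intro h
  have h1 : r.num = C u * r.denom := sub_eq_zero.1 h
  have hu : IsUnit r.denom :=
    r.isCoprime_num_denom.symm.isUnit_of_dvd' dvd_rfl (h1 ▸ Dvd.intro_left _ rfl)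
  have h2 := natDegree_eq_zero_of_isUnit hu
  have := natDegree_C_mul_le u r.denom
  rw [← h1] at this
  omega

theorem setOf_val_eq {r : RatFunc ℂ} (hnum : 0 < r.num.natDegree) (u : ℂ) :
    {z | IsRegularAt r z ∧ val r z = u} = ((pencil r u).roots.toFinset : Set ℂ) := by
  ext z
  simp [pencil_ne_zero hnum, ← eval_pencil_eq_zero_iff, IsRoot]

theorem card_roots_pencil_le {r : RatFunc ℂ} (hdeg : r.denom.natDegree ≤ r.num.natDegree) (u : ℂ) :
    (pencil r u).roots.toFinset.card ≤ deg r :=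
  (Multiset.toFinset_card_le _).trans ((card_roots' _).trans (natDegree_pencil_le hdeg u))

/-- A polynomial of degree less than `N` divided by the denominator of `r`. -/
def overDenom (r : RatFunc ℂ) : ℂ[X] →ₗ[ℂ] RatFunc ℂ :=
  (LinearMap.mulRight ℂ (algebraMap ℂ[X] (RatFunc ℂ) r.denom)⁻¹).comp
    (Algebra.linearMap ℂ[X] (RatFunc ℂ) |>.restrictScalars ℂ)

theorem overDenom_apply (r : RatFunc ℂ) (f : ℂ[X]) :
    overDenom r f = algebraMap ℂ[X] (RatFunc ℂ) f / algebraMap ℂ[X] (RatFunc ℂ) r.denom := by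
  simp [overDenom, div_eq_mul_inv]

theorem stateSpace_le {r : RatFunc ℂ} (hdeg : r.denom.natDegree ≤ r.num.natDegree)
    (hnum : 0 < r.num.natDegree) :
    stateSpace r ≤ (degreeLT ℂ (deg r)).map (overDenom r) := by
  refine Submodule.span_le.2 ?_
  rintro g ⟨a, ha, rfl⟩
  have hd : algebraMap ℂ[X] (RatFunc ℂ) r.denom ≠ 0 := RatFunc.algebraMap_ne_zero r.denom_ne_zero
  have hroot : (pencil r (val r a)).IsRoot a := eval_pencil_eq_zero_iff.2 ⟨ha, rfl⟩
  obtain ⟨f, hf⟩ := dvd_iff_isRoot.2 hroot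
  refine ⟨f, ?_, ?_⟩
  · rw [SetLike.mem_coe, mem_degreeLT]
    have hf0 : f ≠ 0 := by rintro rfl; exact pencil_ne_zero hnum _ (by simpa using hf)
    have := natDegree_pencil_le hdeg (val r a)
    rw [hf, natDegree_mul (X_sub_C_ne_zero a) hf0, natDegree_X_sub_C] at this
    rw [degree_eq_natDegree hf0]
    exact_mod_cast (by omega : f.natDegree < deg r)
  · have hX : (RatFunc.X - RatFunc.C a : RatFunc ℂ) ≠ 0 := by
      have := RatFunc.algebraMap_ne_zero (X_sub_C_ne_zero a)
      simpa using this
    have h2 := congrArg (algebraMap ℂ[X] (RatFunc ℂ)) hf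
    simp only [pencil, map_sub, map_mul, RatFunc.algebraMap_C, RatFunc.algebraMap_X] at h2
    rw [overDenom_apply, div_eq_div_iff hd hX]
    have h3 : algebraMap ℂ[X] (RatFunc ℂ) r.num = r * algebraMap ℂ[X] (RatFunc ℂ) r.denom :=
      (div_eq_iff hd).1 (RatFunc.num_div_denom r)
    rw [h3] at h2
    linear_combination -h2

/-- The elements of a basis of the state space are the quotients by the denominator of a basis of
the polynomials of degree less than `N`. -/
theorem exists_numerators {r : RatFunc ℂ} (hdeg : r.denom.natDegree ≤ r.num.natDegree)
    (hnum : 0 < r.num.natDegree) (e : Module.Basis (Fin (deg r)) ℂ (stateSpace r)) :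
    ∃ b : Fin (deg r) → ℂ[X], (∀ j, b j ∈ degreeLT ℂ (deg r)) ∧
      (∀ j z, IsRegularAt r z → val (e j : RatFunc ℂ) z = (b j).eval z / r.denom.eval z) ∧
      LinearIndependent ℂ b ∧ Submodule.span ℂ (Set.range b) = degreeLT ℂ (deg r) := by
  choose b hb hbe using fun j => stateSpace_le hdeg hnum (e j).2
  have hli : LinearIndependent ℂ b := by
    have h1 : LinearIndependent ℂ (fun j => (e j : RatFunc ℂ)) :=
      e.linearIndependent.map' (stateSpace r).subtype (Submodule.ker_subtype _)
    refine LinearIndependent.of_comp (overDenom r) ?_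
    convert h1 using 2 with j
    exact hbe j
  refine ⟨b, hb, fun j z hz => ?_, hli, ?_⟩
  · rw [← hbe j, overDenom_apply, val_div hz]
  -- The index type of `e` already fixes the dimension as N, so the inclusion `stateSpace_le`
  -- suffices: N independent numerators in an N-dimensional space span it.
  · have : FiniteDimensional ℂ (degreeLT ℂ (deg r)) :=
      Module.Finite.equiv (degreeLTEquiv ℂ (deg r)).symm
    refine Submodule.eq_of_le_of_finrank_eq (Submodule.span_le.2 ?_) ?_
    · rintro _ ⟨j, rfl⟩; exact hb j
    · rw [finrank_span_eq_card hli, (degreeLTEquiv ℂ (deg r)).finrank_eq]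
      simp

theorem eq_zero_of_sum_val_eq_zero {r : RatFunc ℂ} (hdeg : r.denom.natDegree ≤ r.num.natDegree)
    (hnum : 0 < r.num.natDegree) (e : Module.Basis (Fin (deg r)) ℂ (stateSpace r))
    {s : Finset ℂ} (hs : deg r ≤ s.card) (hreg : ∀ z ∈ s, IsRegularAt r z) {c : Fin (deg r) → ℂ}
    (h : ∀ z ∈ s, ∑ j, val (e j : RatFunc ℂ) z * c j = 0) : c = 0 := by
  obtain ⟨b, hb, hbe, hli, -⟩ := exists_numerators hdeg hnum e
  have hz : ∑ j, c j • b j = 0 := by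
    have hmem : ∑ j, c j • b j ∈ degreeLT ℂ (deg r) :=
      Submodule.sum_mem _ fun j _ => Submodule.smul_mem _ _ (hb j)
    refine eq_zero_of_degree_lt_of_eval_finset_eq_zero s
      ((mem_degreeLT.1 hmem).trans_le (by exact_mod_cast hs)) fun z hzs => ?_
    have := h z hzs
    simp only [hbe _ z (hreg z hzs), div_mul_eq_mul_div] at this
    rw [← Finset.sum_div, div_eq_zero_iff, or_iff_left (hreg z hzs)] at this
    rw [eval_finsetSum, ← this]
    exact Finset.sum_congr rfl fun j _ => by simp [mul_comm]
  exact funext fun j => Fintype.linearIndependent_iff.1 hli c hz j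

/-! ### The simple values -/

/-- At a multiple root of n - uq both n = uq and n' = uq', so the Wronskian of n and q vanishes
there. It is a nonzero polynomial because n, q are coprime and n is not constant. -/
theorem finite_not_separable {r : RatFunc ℂ} (hnum : 0 < r.num.natDegree) :
    {u | ∃ z, (pencil r u).eval z = 0 ∧ (derivative (pencil r u)).eval z = 0}.Finite := by
  have hw : wronskian r.num r.denom ≠ 0 := by
    rw [Ne, r.isCoprime_num_denom.wronskian_eq_zero_iff]
    rintro ⟨h, -⟩
    have := derivative_eq_zero.1 h
    omega
  refine (((wronskian r.num r.denom).roots.toFinset.finite_toSet).image (val r)).subset ?_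
  rintro u ⟨z, h1, h2⟩
  refine ⟨z, ?_, (eval_pencil_eq_zero_iff.1 h1).2⟩
  rw [eval_pencil] at h1
  simp only [pencil, derivative_sub, derivative_C_mul, eval_sub, eval_mul, eval_C] at h2
  rw [Finset.mem_coe, Multiset.mem_toFinset, mem_roots hw, IsRoot, wronskian, eval_sub, eval_mul,
    eval_mul]
  linear_combination (derivative r.denom).eval z * h1 - r.denom.eval z * h2

theorem card_roots_pencil {r : RatFunc ℂ} {u : ℂ}
    (hu : ¬ ∃ z, (pencil r u).eval z = 0 ∧ (derivative (pencil r u)).eval z = 0) :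
    (pencil r u).roots.toFinset.card = (pencil r u).natDegree := by
  have hn : (pencil r u).roots.Nodup := by
    rcases eq_or_ne (pencil r u) 0 with h0 | h0
    · simp [h0]
    rw [Multiset.nodup_iff_count_le_one]
    intro z
    rw [count_roots]
    by_contra! hc
    exact hu ⟨z, (one_lt_rootMultiplicity_iff_isRoot h0).1 hc⟩
  rw [Multiset.toFinset_card_of_nodup hn]
  exact ((splits_iff_card_roots).1 (IsAlgClosed.splits _))

/-! ### Topology of A(r), and the exceptional value r(∞). -/

variable {r : RatFunc ℂ} {D : DiskSystem r}

theorem mem_domain_of_eval_pencil {u z : ℂ} (hu : u ∈ D.A) (h : (pencil r u).eval z = 0) :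
    z ∈ D.domain := by
  obtain ⟨h1, h2⟩ := eval_pencil_eq_zero_iff.1 h
  exact ⟨h1, h2 ▸ hu⟩

theorem eval_pencil_val (z : D.domain) : (pencil r (val r z)).eval (z : ℂ) = 0 :=
  eval_pencil_eq_zero_iff.2 ⟨z.2.1, rfl⟩

theorem continuousOn_val : ContinuousOn (val r) {z | IsRegularAt r z} := by
  have : val r = fun z => r.num.eval z / r.denom.eval z := funext (val_eq r)
  rw [this]
  exact r.num.continuous.continuousOn.div r.denom.continuous.continuousOn fun z hz => hz

theorem isOpen_A (hnum : 0 < r.num.natDegree) : IsOpen D.A := by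
  rw [DiskSystem.A, isOpen_compl_iff]
  have hfin : {w : ℂ | r.num.IsRoot w}.Finite :=
    finite_setOfPred_isRoot (by rintro h; simp [h] at hnum)
  have hc : IsCompact (circles r D.center D.radius) :=
    hfin.isCompact_biUnion fun w _ => isCompact_sphere _ _
  refine (hc.image_of_continuousOn (continuousOn_val.mono ?_)).isClosed
  intro z hz
  simp only [circles, Set.mem_iUnion] at hz
  obtain ⟨w, hw, hz⟩ := hz
  exact D.regular w hw z (Metric.sphere_subset_closedBall hz)

theorem coeff_pencil (u : ℂ) :
    (pencil r u).coeff (deg r) = r.num.coeff (deg r) - u * r.denom.coeff (deg r) := by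
  simp [pencil]

theorem natDegree_pencil_eq_iff (hdeg : r.denom.natDegree ≤ r.num.natDegree)
    (hnum : 0 < r.num.natDegree) {u : ℂ} :
    (pencil r u).natDegree = deg r ↔
      r.num.coeff (deg r) - u * r.denom.coeff (deg r) ≠ 0 := by
  rw [← coeff_pencil]
  constructor
  · intro h
    rw [← h]
    exact leadingCoeff_ne_zero.2 (pencil_ne_zero hnum u)
  · exact fun h => le_antisymm (natDegree_pencil_le hdeg u) (le_natDegree_of_ne_zero h)

theorem mem_finiteA_iff {u : ℂ} :
    u ∈ D.finiteA ↔ u ∈ D.A ∧ (pencil r u).natDegree = deg r := Iff.rfl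

theorem isOpen_finiteA (hdeg : r.denom.natDegree ≤ r.num.natDegree) (hnum : 0 < r.num.natDegree) :
    IsOpen D.finiteA := by
  have : D.finiteA =
      D.A ∩ {u | r.num.coeff (deg r) - u * r.denom.coeff (deg r) ≠ 0} := by
    ext u
    rw [mem_finiteA_iff, natDegree_pencil_eq_iff hdeg hnum]
    rfl
  rw [this]
  exact (isOpen_A hnum).inter (isOpen_ne_fun (by fun_prop) (by fun_prop))

/-- `A(r)` is `finiteA` up to the single point `r(∞)`. -/
theorem exists_finiteA_eq_diff (hdeg : r.denom.natDegree ≤ r.num.natDegree)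
    (hnum : 0 < r.num.natDegree) : D.finiteA = D.A ∨ ∃ u, D.finiteA = D.A \ {u} := by
  have hlc : r.num.coeff (deg r) ≠ 0 := leadingCoeff_ne_zero.2 (by rintro h; simp [h] at hnum)
  by_cases h : r.denom.coeff (deg r) = 0
  · left
    ext u
    rw [mem_finiteA_iff, natDegree_pencil_eq_iff hdeg hnum]
    simp [h, -coeff_natDegree, hlc]
  · right
    -- This quotient of the coefficients of degree N is r(∞), the only value at which n - uq drops
    -- in degree.
    refine ⟨r.num.coeff (deg r) / r.denom.coeff (deg r), ?_⟩
    ext u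
    rw [mem_finiteA_iff, natDegree_pencil_eq_iff hdeg hnum, Set.mem_sdiff, Set.mem_singleton_iff,
      eq_div_iff h, sub_ne_zero, ne_comm]

/-! ### Fibres with N different points. -/

variable {a : Fin (deg r) → D.domain} {α : ℂ}

/-- A fibre consists of all the roots of `r = α`. -/
theorem image_fibre (hdeg : r.denom.natDegree ≤ r.num.natDegree)
    (hnum : 0 < r.num.natDegree) (ha : IsFibre α a) :
    Finset.univ.image (fun n => (a n : ℂ)) = (pencil r α).roots.toFinset := by
  have hsub : Finset.univ.image (fun n => (a n : ℂ)) ⊆ (pencil r α).roots.toFinset := by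
    intro z hz
    obtain ⟨n, -, rfl⟩ := Finset.mem_image.1 hz
    rw [Multiset.mem_toFinset, mem_roots (pencil_ne_zero hnum α), IsRoot, ← ha.2 n]
    exact eval_pencil_val (a n)
  refine Finset.eq_of_subset_of_card_le hsub ?_
  rw [Finset.card_image_of_injective _ (f := fun n => (a n : ℂ)) (Subtype.val_injective.comp ha.1)]
  simpa using card_roots_pencil_le hdeg α

theorem exists_eq_fibre (hdeg : r.denom.natDegree ≤ r.num.natDegree)
    (hnum : 0 < r.num.natDegree) (ha : IsFibre α a) {z : D.domain} (hz : val r z = α) :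
    ∃ n, a n = z := by
  have h : (z : ℂ) ∈ (pencil r α).roots.toFinset := by
    rw [Multiset.mem_toFinset, mem_roots (pencil_ne_zero hnum α), IsRoot, ← hz]
    exact eval_pencil_val z
  rw [← image_fibre hdeg hnum ha] at h
  obtain ⟨n, -, hn⟩ := Finset.mem_image.1 h
  exact ⟨n, Subtype.ext hn⟩

theorem card_roots_of_fibre (hdeg : r.denom.natDegree ≤ r.num.natDegree)
    (hnum : 0 < r.num.natDegree) (ha : IsFibre α a) :
    (pencil r α).roots.toFinset.card = deg r := by
  rw [← image_fibre hdeg hnum ha,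
    Finset.card_image_of_injective _ (f := fun n => (a n : ℂ)) (Subtype.val_injective.comp ha.1)]
  simp

theorem mem_simpleValues_of_fibre (hdeg : r.denom.natDegree ≤ r.num.natDegree)
    (hnum : 0 < r.num.natDegree) (ha : IsFibre α a) : α ∈ simpleValues r := by
  rw [simpleValues, Set.mem_ofPred_eq, setOf_val_eq hnum, Set.ncard_coe_finset,
    card_roots_of_fibre hdeg hnum ha]

theorem mem_finiteA_of_fibre (hdeg : r.denom.natDegree ≤ r.num.natDegree)
    (hnum : 0 < r.num.natDegree) (ha : IsFibre α a) : α ∈ D.finiteA := by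
  refine mem_finiteA_iff.2 ⟨?_, le_antisymm (natDegree_pencil_le hdeg α) ?_⟩
  · rw [← ha.2 ⟨0, hnum⟩]
    exact (a ⟨0, hnum⟩).2.2
  · calc deg r = (pencil r α).roots.toFinset.card := (card_roots_of_fibre hdeg hnum ha).symm
      _ ≤ _ := (Multiset.toFinset_card_le _).trans (card_roots' _)

end

end RationalPontryagin

namespace RationalPontryagin
open Polynomial

noncomputable section

/-! ### Analytic division by the pencil `n - u q` -/

open Filter Topology Metric MeasureTheory

/-- This bound holds on an unbounded set, so roots escaping to infinity are controlled too. Split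
q(z) = q(w) + (z - w) q₁(z) and induct; the constant q(w) is absorbed since the product is at least
a power of ε. -/
theorem exists_norm_eval_le_prod {ε : ℝ} (hε : 0 < ε) (s : Multiset ℂ) :
    ∀ q : ℂ[X], q.natDegree ≤ s.card → ∃ B : ℝ, 0 ≤ B ∧
      ∀ z, (∀ w ∈ s, ε ≤ ‖z - w‖) → ‖q.eval z‖ ≤ B * ‖(s.map fun w => z - w).prod‖ := by
  induction s using Multiset.induction with
  | empty =>
    intro q hq
    refine ⟨‖q.coeff 0‖, norm_nonneg _, fun z _ => ?_⟩
    rw [eq_C_of_natDegree_le_zero (show q.natDegree ≤ 0 by simpa using hq)]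
    simp
  | cons w s ih =>
    intro q hq
    obtain ⟨B, hB, h⟩ := ih (q /ₘ (X - C w)) (by
      rw [natDegree_divByMonic _ (monic_X_sub_C w), natDegree_X_sub_C]
      rw [Multiset.card_cons] at hq
      omega)
    refine ⟨B + ‖q.eval w‖ / ε ^ (s.card + 1), by positivity, fun z hz => ?_⟩
    have hs : ∀ t : Multiset ℂ, (∀ w ∈ t, ε ≤ ‖z - w‖) →
        ε ^ t.card ≤ ‖(t.map fun w => z - w).prod‖ := by
      intro t
      induction t using Multiset.induction with
      | empty => simp
      | cons v t ih' =>
        intro ht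
        rw [Multiset.card_cons, Multiset.map_cons, Multiset.prod_cons, norm_mul, pow_succ']
        exact mul_le_mul (ht v (Multiset.mem_cons_self v t))
          (ih' fun w hw => ht w (Multiset.mem_cons_of_mem hw)) (by positivity) (norm_nonneg _)
    have h1 := hs _ hz
    have h2 := h z fun v hv => hz v (Multiset.mem_cons_of_mem hv)
    have hq' : q.eval z = q.eval w + (z - w) * (q /ₘ (X - C w)).eval z := by
      conv_lhs => rw [← modByMonic_add_div q (X - C w), modByMonic_X_sub_C_eq_C_eval]
      simp
    rw [Multiset.card_cons] at h1
    rw [Multiset.map_cons, Multiset.prod_cons, norm_mul] at h1 ⊢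
    calc ‖q.eval z‖ ≤ ‖q.eval w‖ + ‖z - w‖ * ‖(q /ₘ (X - C w)).eval z‖ := by
          rw [hq', ← norm_mul]; exact norm_add_le _ _
      _ ≤ ‖q.eval w‖ / ε ^ (s.card + 1) * (‖z - w‖ * ‖(s.map fun w => z - w).prod‖) +
          ‖z - w‖ * (B * ‖(s.map fun w => z - w).prod‖) := by
        gcongr
        rw [div_mul_eq_mul_div, le_div_iff₀ (by positivity)]
        gcongr
      _ = _ := by ring

/-- The coefficient of `z ^ k` in the divided difference `(f(s) - f(z)) / (s - z)`. -/
def divDiffCoeff (N : ℕ) (f : ℂ[X]) (k : ℕ) (s : ℂ) : ℂ :=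
  ∑ m ∈ Finset.range (N + 1), if k < m then f.coeff m * s ^ (m - 1 - k) else 0

theorem sum_divDiffCoeff {N : ℕ} {f : ℂ[X]} (hf : f.natDegree ≤ N) (s z : ℂ) :
    (∑ k : Fin N, z ^ (k : ℕ) * divDiffCoeff N f k s) * (s - z) = f.eval s - f.eval z := by
  have h1 : ∀ m ∈ Finset.range (N + 1),
      (∑ k ∈ Finset.range N, z ^ k * if k < m then f.coeff m * s ^ (m - 1 - k) else 0) * (s - z) =
        f.coeff m * s ^ m - f.coeff m * z ^ m := by
    intro m hm
    rw [Finset.mem_range] at hm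
    have : (∑ k ∈ Finset.range N, z ^ k * if k < m then f.coeff m * s ^ (m - 1 - k) else 0) =
        f.coeff m * ∑ k ∈ Finset.range m, z ^ k * s ^ (m - 1 - k) := by
      rw [Finset.mul_sum, ← Finset.sum_subset (Finset.range_subset_range.2 (by omega : m ≤ N))]
      · exact Finset.sum_congr rfl fun k hk => by
          rw [if_pos (Finset.mem_range.1 hk)]; ring
      · intro k _ hk
        rw [if_neg (by simpa using hk), mul_zero]
    rw [this]
    linear_combination -f.coeff m * (Commute.all z s).geom_sum₂_mul m
  rw [Fin.sum_univ_eq_sum_range (fun k => z ^ k * divDiffCoeff N f k s),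
    eval_eq_sum_range' (Nat.lt_succ_of_le hf), eval_eq_sum_range' (Nat.lt_succ_of_le hf),
    ← Finset.sum_sub_distrib, ← Finset.sum_congr rfl h1, ← Finset.sum_mul]
  simp only [divDiffCoeff, Finset.mul_sum]
  rw [Finset.sum_comm]

theorem divDiffCoeff_sub_C_mul (N : ℕ) (f g : ℂ[X]) (u : ℂ) (k : ℕ) (s : ℂ) :
    divDiffCoeff N (f - C u * g) k s = divDiffCoeff N f k s - u * divDiffCoeff N g k s := by
  simp only [divDiffCoeff, Finset.mul_sum, ← Finset.sum_sub_distrib]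
  refine Finset.sum_congr rfl fun m _ => ?_
  split_ifs
  · simp; ring
  · simp

theorem continuous_divDiffCoeff (N : ℕ) (f : ℂ[X]) (k : ℕ) : Continuous (divDiffCoeff N f k) := by
  unfold divDiffCoeff
  refine continuous_finsetSum _ fun m _ => ?_
  split_ifs <;> fun_prop

theorem differentiableOn_circleIntegral_div {c : ℂ} {R : ℝ} (hR : 0 ≤ R) {φ n q : ℂ → ℂ}
    (hφ : ContinuousOn φ (sphere c R)) (hn : Continuous n) (hq : Continuous q) {u₀ : ℂ} {δ : ℝ}
    (h : ∀ u ∈ ball u₀ δ, ∀ s ∈ sphere c R, n s - u * q s ≠ 0) :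
    DifferentiableOn ℂ (fun u => ∮ s in C(c, R), φ s / (n s - u * q s)) (ball u₀ δ) := by
  intro u₁ hu₁
  obtain ⟨η, hη, hsub⟩ := nhds_basis_closedBall.mem_iff.1 (isOpen_ball.mem_nhds hu₁)
  let Φ : ℂ → ℝ → ℂ := fun u t =>
    deriv (circleMap c R) t • (φ (circleMap c R t) / (n (circleMap c R t) - u * q (circleMap c R t)))
  let Φ' : ℂ → ℝ → ℂ := fun u t =>
    deriv (circleMap c R) t • (φ (circleMap c R t) * q (circleMap c R t) /
      (n (circleMap c R t) - u * q (circleMap c R t)) ^ 2)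
  have hm : ∀ t, circleMap c R t ∈ sphere c R := fun t => circleMap_mem_sphere c hR t
  have hφc : Continuous fun t => φ (circleMap c R t) :=
    hφ.comp_continuous (continuous_circleMap c R) hm
  have hnc := hn.comp (continuous_circleMap c R)
  have hqc := hq.comp (continuous_circleMap c R)
  have hdc : Continuous (deriv (circleMap c R)) := by
    have : deriv (circleMap c R) = fun t => circleMap 0 R t * Complex.I :=
      funext fun t => deriv_circleMap c R t
    rw [this]
    fun_prop
  have hΦ : ∀ u ∈ ball u₀ δ, Continuous (Φ u) := fun u hu =>
    hdc.smul (hφc.div (hnc.sub (continuous_const.mul hqc)) fun t => h u hu _ (hm t))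
  have hΦ' : ContinuousOn (Function.uncurry Φ') (closedBall u₁ η ×ˢ Set.Icc 0 (2 * Real.pi)) := by
    refine ContinuousOn.smul (hdc.comp continuous_snd).continuousOn (ContinuousOn.div ?_ ?_ ?_)
    · exact ((hφc.mul hqc).comp continuous_snd).continuousOn
    · exact (((hnc.comp continuous_snd).sub
        (continuous_fst.mul (hqc.comp continuous_snd))).pow 2).continuousOn
    · intro x hx
      exact pow_ne_zero 2 (h _ (hsub hx.1) _ (hm _))
  obtain ⟨B, hB⟩ := ((isCompact_closedBall u₁ η).prod isCompact_Icc).exists_bound_of_continuousOn hΦ'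
  refine (intervalIntegral.hasDerivAt_integral_of_dominated_loc_of_deriv_le
    (F := Φ) (F' := Φ') (bound := fun _ => B) (closedBall_mem_nhds u₁ hη) ?_ ?_ ?_ ?_ ?_ ?_
    ).2.differentiableAt.differentiableWithinAt
  · filter_upwards [isOpen_ball.mem_nhds hu₁] with u hu
    exact (hΦ u hu).aestronglyMeasurable
  · exact (hΦ u₁ hu₁).intervalIntegrable _ _
  · refine Continuous.aestronglyMeasurable ?_
    exact hdc.smul ((hφc.mul hqc).div ((hnc.sub (continuous_const.mul hqc)).pow 2)
      fun t => pow_ne_zero 2 (h _ hu₁ _ (hm _)))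
  · refine Eventually.of_forall fun t ht u hu => hB (u, t) ⟨hu, ?_⟩
    rw [Set.uIoc_of_le (by positivity)] at ht
    exact Set.Ioc_subset_Icc_self ht
  · exact intervalIntegrable_const
  · refine Eventually.of_forall fun t _ u hu => ?_
    have hne := h u (hsub hu) _ (hm t)
    have h1 : HasDerivAt (fun u => n (circleMap c R t) - u * q (circleMap c R t))
        (-q (circleMap c R t)) u := by
      simpa using ((hasDerivAt_id u).mul_const (q (circleMap c R t))).const_sub
        (n (circleMap c R t))
    have h2 := ((hasDerivAt_const u (φ (circleMap c R t))).div h1 hne).const_smul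
      (deriv (circleMap c R) t)
    refine HasDerivAt.congr_deriv h2 ?_
    simp only [smul_eq_mul, Φ']
    ring

theorem exists_separating_radius {h : ℂ → ℂ} (Z : Finset ℂ) (hZ : ∀ z ∈ Z, AnalyticAt ℂ h z) :
    ∃ ε > 0, (∀ z ∈ Z, ∀ y ∈ closedBall z ε, AnalyticAt ℂ h y) ∧
      ∀ z ∈ Z, ∀ w ∈ Z, z ≠ w → Disjoint (closedBall z ε) (closedBall w ε) := by
  have h1 : ∀ z ∈ Z, ∀ᶠ ε in 𝓝[>] (0 : ℝ), ∀ y ∈ closedBall z ε, AnalyticAt ℂ h y := by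
    intro z hz
    obtain ⟨η, hη, hs⟩ := nhds_basis_closedBall.mem_iff.1 (hZ z hz).eventually_analyticAt
    filter_upwards [Ioc_mem_nhdsGT hη] with ε hε y hy
    exact hs (closedBall_subset_closedBall hε.2 hy)
  have h2 : ∀ z ∈ Z, ∀ w ∈ Z, ∀ᶠ ε in 𝓝[>] (0 : ℝ),
      z ≠ w → Disjoint (closedBall z ε) (closedBall w ε) := by
    intro z _ w _
    by_cases hzw : z = w
    · exact Eventually.of_forall fun _ h => absurd hzw h
    have hd : 0 < dist z w / 2 := half_pos (dist_pos.2 hzw)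
    filter_upwards [Ioo_mem_nhdsGT hd] with ε hε _
    exact closedBall_disjoint_closedBall (by linarith [hε.2])
  have h0 : ∀ᶠ ε in 𝓝[>] (0 : ℝ), 0 < ε := self_mem_nhdsWithin
  obtain ⟨ε, hε, h3, h4⟩ := (h0.and
    (((Finset.eventually_all Z).2 h1).and
      ((Finset.eventually_all Z).2 fun z hz => (Finset.eventually_all Z).2 (h2 z hz)))).exists
  exact ⟨ε, hε, h3, h4⟩

/-- For `u` near `u₀`, all the roots of `n - u q` are close to those of `n - u₀ q`, provided that
the degree of `n - u₀ q` is at least that of `q`. -/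
theorem exists_ball_eval_sub_ne_zero {n q : ℂ[X]} {u₀ : ℂ}
    (h0 : n - C u₀ * q ≠ 0) (hq : q.natDegree ≤ (n - C u₀ * q).natDegree) {ε : ℝ} (hε : 0 < ε) :
    ∃ δ > 0, ∀ u ∈ ball u₀ δ, ∀ z, (n - C u * q).eval z = 0 →
      ∃ w ∈ (n - C u₀ * q).roots.toFinset, z ∈ ball w ε := by
  set f := n - C u₀ * q with hf
  have hs := IsAlgClosed.splits f
  obtain ⟨B, hB, h⟩ := exists_norm_eval_le_prod hε f.roots q
    (hq.trans (splits_iff_card_roots.1 hs).ge)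
  have hlc : 0 < ‖f.leadingCoeff‖ := norm_pos_iff.2 (leadingCoeff_ne_zero.2 h0)
  -- A root z of n - uq has f(z) = (u - u₀) q(z). Far from the roots of f this forces |lc f| ≤ |u -
  -- u₀| B, which the chosen radius excludes; the 1 guards against B = 0.
  refine ⟨‖f.leadingCoeff‖ / (B + 1), by positivity, fun u hu z hz => ?_⟩
  by_contra! hc
  have hz' : ∀ w ∈ f.roots, ε ≤ ‖z - w‖ := by
    intro w hw
    have := hc w (Multiset.mem_toFinset.2 hw)
    rwa [mem_ball, dist_eq_norm, not_lt] at this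
  have h1 := h z hz'
  have h2 : f.eval z = f.leadingCoeff * (f.roots.map fun w => z - w).prod := by
    conv_lhs => rw [hs.eq_prod_roots]
    rw [eval_C_mul, eval_multiset_prod, Multiset.map_map]
    simp
  have h3 : f.eval z = (u - u₀) * q.eval z := by
    rw [eval_sub, eval_C_mul] at hz
    rw [hf, eval_sub, eval_C_mul]
    linear_combination hz
  set m := (f.roots.map fun w => z - w).prod with hm
  have hpos : 0 < ‖m‖ := by
    rw [norm_pos_iff, hm]
    refine Multiset.prod_ne_zero fun h4 => ?_
    obtain ⟨w, hw, hw0⟩ := Multiset.mem_map.1 h4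
    have := hz' w hw
    rw [hw0, norm_zero] at this
    linarith
  have h5 : ‖f.leadingCoeff‖ * ‖m‖ ≤ ‖u - u₀‖ * (B * ‖m‖) := by
    rw [← norm_mul, ← h2, h3, norm_mul]
    gcongr
  rw [mem_ball, dist_eq_norm, lt_div_iff₀ (by positivity)] at hu
  have h6 : ‖f.leadingCoeff‖ ≤ ‖u - u₀‖ * B := le_of_mul_le_mul_right (by linarith) hpos
  nlinarith [norm_nonneg (u - u₀)]

/-- With f = n - uq, integrate h(s) (f(s) - f(z)) / ((s - z) f(s)) over small circles around the
roots of n - u₀q. The divided difference makes this a polynomial in z of degree less than N with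
coefficients analytic in u; at a root z of f it reduces to Cauchy's integral for h(z). -/
theorem exists_analyticAt_division {n q : ℂ[X]} {u₀ : ℂ} {N : ℕ} (hn : n.natDegree ≤ N)
    (hq : q.natDegree ≤ N) (h0 : n - C u₀ * q ≠ 0) (hdeg : (n - C u₀ * q).natDegree = N)
    {h : ℂ → ℂ} (hh : ∀ z, (n - C u₀ * q).eval z = 0 → AnalyticAt ℂ h z) :
    ∃ G : Fin N → ℂ → ℂ, (∀ k, AnalyticAt ℂ (G k) u₀) ∧
      ∀ᶠ u in 𝓝 u₀, ∀ z, (n - C u * q).eval z = 0 → ∑ k : Fin N, z ^ (k : ℕ) * G k u = h z := by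
  obtain ⟨ε, hε, hε1, hε2⟩ := exists_separating_radius (n - C u₀ * q).roots.toFinset
    (h := h) fun z hz => hh z (by simpa [h0] using hz)
  set Z := (n - C u₀ * q).roots.toFinset
  obtain ⟨δ, hδ, hroot⟩ := exists_ball_eval_sub_ne_zero h0 (by rwa [hdeg]) hε
  have hsphere : ∀ w ∈ Z, ∀ u ∈ ball u₀ δ, ∀ s ∈ sphere w ε, n.eval s - u * q.eval s ≠ 0 := by
    intro w hw u hu s hs hc
    obtain ⟨v, hv, hsv⟩ := hroot u hu s (by simpa using hc)
    by_cases hvw : v = w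
    · subst hvw
      rw [mem_sphere] at hs; rw [mem_ball] at hsv; linarith
    · exact Set.disjoint_left.1 (hε2 v hv w hw hvw) (ball_subset_closedBall hsv)
        (sphere_subset_closedBall hs)
  have hhc : ∀ w ∈ Z, ContinuousOn h (closedBall w ε) := fun w hw s hs =>
    (hε1 w hw s hs).continuousAt.continuousWithinAt
  have hhs : ∀ w ∈ Z, ContinuousOn h (sphere w ε) := fun w hw =>
    (hhc w hw).mono sphere_subset_closedBall
  -- The divided difference of n - uq is linear in u. Treating n and q separately leaves u only in
  -- the denominator of each integrand.
  let I : ℂ[X] → Fin N → ℂ → ℂ → ℂ := fun f k w u =>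
    ∮ s in C(w, ε), h s * divDiffCoeff N f k s / (n.eval s - u * q.eval s)
  let G : Fin N → ℂ → ℂ := fun k u =>
    ∑ w ∈ Z, (2 * Real.pi * Complex.I : ℂ)⁻¹ * (I n k w u - u * I q k w u)
  have hI : ∀ f k, ∀ w ∈ Z, DifferentiableOn ℂ (I f k w) (ball u₀ δ) := fun f k w hw =>
    differentiableOn_circleIntegral_div hε.le
      ((hhs w hw).mul (continuous_divDiffCoeff N f k).continuousOn)
      n.continuous q.continuous (hsphere w hw)
  have hG : ∀ k, DifferentiableOn ℂ (G k) (ball u₀ δ) := fun k =>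
    DifferentiableOn.fun_sum fun w hw =>
      ((hI n k w hw).sub (differentiableOn_id.mul (hI q k w hw))).const_mul _
  refine ⟨G, fun k => (hG k).analyticAt (ball_mem_nhds u₀ hδ), ?_⟩
  filter_upwards [ball_mem_nhds u₀ hδ] with u hu z hz
  obtain ⟨v, hv, hzv⟩ := hroot u hu z hz
  have hint : ∀ f k, ∀ w ∈ Z, CircleIntegrable
      (fun s => h s * divDiffCoeff N f k s / (n.eval s - u * q.eval s)) w ε := fun f k w hw =>
    ContinuousOn.circleIntegrable hε.le
      (((hhs w hw).mul (continuous_divDiffCoeff N f k).continuousOn).div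
        (n.continuous.sub (continuous_const.mul q.continuous)).continuousOn (hsphere w hw u hu))
  have hkey : ∀ w ∈ Z, ∑ k : Fin N, z ^ (k : ℕ) *
      ((2 * Real.pi * Complex.I : ℂ)⁻¹ * (I n k w u - u * I q k w u)) =
      (2 * Real.pi * Complex.I : ℂ)⁻¹ * ∮ s in C(w, ε), (s - z)⁻¹ • h s := by
    intro w hw
    have hzs : ∀ s ∈ sphere w ε, s - z ≠ 0 := by
      intro s hs hc
      rw [sub_eq_zero] at hc
      subst hc
      exact hsphere w hw u hu s hs (by simpa using hz)
    have hint' : ∀ f k, CircleIntegrable (fun s => u * (h s * divDiffCoeff N f k s /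
        (n.eval s - u * q.eval s))) w ε := fun f k => (hint f k w hw).const_smul (a := u)
    have : ∀ k : Fin N, z ^ (k : ℕ) * (I n k w u - u * I q k w u) =
        ∮ s in C(w, ε), z ^ (k : ℕ) * (h s * divDiffCoeff N n k s / (n.eval s - u * q.eval s) -
          u * (h s * divDiffCoeff N q k s / (n.eval s - u * q.eval s))) := by
      intro k
      rw [circleIntegral.integral_const_mul,
        circleIntegral.integral_sub (hint n k w hw) (hint' q k), circleIntegral.integral_const_mul]
    simp_rw [mul_left_comm _ (2 * Real.pi * Complex.I : ℂ)⁻¹, ← Finset.mul_sum]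
    simp_rw [this]
    congr 1
    refine (circleIntegral.integral_fun_sum fun (k : Fin N) _ =>
      ((hint n k w hw).sub (hint' q k)).const_smul (a := z ^ (k : ℕ))).symm.trans ?_
    refine circleIntegral.integral_congr hε.le fun s hs => ?_
    have hne := hsphere w hw u hu s hs
    have hf : (n - C u * q).natDegree ≤ N :=
      (natDegree_sub_le _ _).trans (max_le hn ((natDegree_C_mul_le _ _).trans hq))
    have hd := sum_divDiffCoeff hf s z
    simp only [divDiffCoeff_sub_C_mul] at hd
    rw [hz, sub_zero, eval_sub, eval_C_mul] at hd
    have hsum : ∑ k : Fin N, z ^ (k : ℕ) *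
        (h s * divDiffCoeff N n k s / (n.eval s - u * q.eval s) -
          u * (h s * divDiffCoeff N q k s / (n.eval s - u * q.eval s))) =
        (∑ k : Fin N, z ^ (k : ℕ) * (divDiffCoeff N n k s - u * divDiffCoeff N q k s)) *
          (h s / (n.eval s - u * q.eval s)) := by
      rw [Finset.sum_mul]
      exact Finset.sum_congr rfl fun k _ => by ring
    refine hsum.trans ?_
    rw [smul_eq_mul, inv_mul_eq_div, ← mul_div_assoc, div_eq_div_iff hne (hzs s hs), ← hd]
    ring
  -- Only the circle around `v`, which encloses z, contributes; on the other disks h(s)/(s - z) is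
  -- holomorphic.
  simp only [G, Finset.mul_sum]
  rw [Finset.sum_comm, Finset.sum_congr rfl hkey, Finset.sum_eq_single v]
  · have := (show DiffContOnCl ℂ h (ball v ε) from ?_).two_pi_i_inv_smul_circleIntegral_sub_inv_smul hzv
    · simpa using this
    · refine DifferentiableOn.diffContOnCl fun s hs => ?_
      rw [closure_ball v hε.ne'] at hs
      exact (hε1 v hv s hs).differentiableAt.differentiableWithinAt
  · intro w hw hwv
    rw [DiffContOnCl.circleIntegral_eq_zero hε.le, mul_zero]
    refine DifferentiableOn.diffContOnCl fun s hs => ?_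
    rw [closure_ball w hε.ne'] at hs
    refine (DifferentiableAt.smul (DifferentiableAt.inv (differentiableAt_id.sub_const z) ?_)
      (hε1 w hw s hs).differentiableAt).differentiableWithinAt
    intro hc
    rw [sub_eq_zero] at hc
    subst hc
    exact Set.disjoint_left.1 (hε2 w hw v hv hwv) hs (ball_subset_closedBall hzv)
  · exact fun h => absurd hv h

end

end RationalPontryagin

namespace RationalPontryagin
open Polynomial

noncomputable section

open Filter Topology Metric

variable {r : RatFunc ℂ} {D : DiskSystem r}

/-! ### Global coefficients with respect to a basis of the state space -/

theorem eventually_notMem_of_finite {s : Set ℂ} (hs : s.Finite) (u : ℂ) : ∀ᶠ v in 𝓝[≠] u, v ∉ s := by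
  rw [eventually_nhdsWithin_iff]
  filter_upwards [(hs.subset (Set.sdiff_subset (t := {u}))).isClosed.isOpen_compl.mem_nhds
    (show u ∈ (s \ {u})ᶜ by simp)] with v hv hvu hvs
  exact hv ⟨hvs, hvu⟩

theorem exists_coeff_of_mem_degreeLT (hdeg : r.denom.natDegree ≤ r.num.natDegree)
    (hnum : 0 < r.num.natDegree) (e : Module.Basis (Fin (deg r)) ℂ (stateSpace r))
    {f : ℂ[X]} (hf : f ∈ degreeLT ℂ (deg r)) :
    ∃ c : Fin (deg r) → ℂ, ∀ z, IsRegularAt r z →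
      ∑ j, val (e j : RatFunc ℂ) z * c j = f.eval z / r.denom.eval z := by
  obtain ⟨b, -, hbe, -, hspan⟩ := exists_numerators hdeg hnum e
  rw [← hspan, Submodule.mem_span_range_iff_exists_fun] at hf
  obtain ⟨c, rfl⟩ := hf
  refine ⟨c, fun z hz => ?_⟩
  rw [eval_finsetSum, Finset.sum_div]
  refine Finset.sum_congr rfl fun j _ => ?_
  rw [hbe j z hz, eval_smul, smul_eq_mul]
  ring

theorem exists_local_coefficients (hdeg : r.denom.natDegree ≤ r.num.natDegree)
    (hnum : 0 < r.num.natDegree) (e : Module.Basis (Fin (deg r)) ℂ (stateSpace r))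
    {F : ℂ → ℂ} (hF : AnalyticOnNhd ℂ F D.domain) {u₀ : ℂ} (hu₀ : u₀ ∈ D.finiteA) :
    ∃ G : Fin (deg r) → ℂ → ℂ, (∀ k, AnalyticAt ℂ (G k) u₀) ∧
      ∀ᶠ u in 𝓝 u₀, ∀ z : D.domain, val r z = u → ∑ k, val (e k : RatFunc ℂ) z * G k u = F z := by
  -- The entries of Z_r are polynomials over q, so it is qF that has to be reduced modulo n - uq.
  obtain ⟨G, hG, hGz⟩ := exists_analyticAt_division (n := r.num) (q := r.denom) (u₀ := u₀)
    le_rfl hdeg (pencil_ne_zero hnum u₀) hu₀.2 (h := fun z => r.denom.eval z * F z)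
    fun z hz => (AnalyticOnNhd.eval_polynomial r.denom z (Set.mem_univ z)).mul
      (hF z (mem_domain_of_eval_pencil hu₀.1 hz))
  choose c hc using fun k : Fin (deg r) => exists_coeff_of_mem_degreeLT hdeg hnum e
    (f := X ^ (k : ℕ)) (mem_degreeLT.2 (by simp))
  refine ⟨fun j u => ∑ k, c k j * G k u,
    fun j => Finset.analyticAt_fun_sum _ fun k _ => analyticAt_const.mul (hG k), ?_⟩
  filter_upwards [hGz] with u hu z hz
  have hz0 : r.denom.eval (z : ℂ) ≠ 0 := z.2.1
  have h1 := hu z (eval_pencil_eq_zero_iff.2 ⟨z.2.1, hz⟩)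
  simp_rw [Finset.mul_sum]
  rw [Finset.sum_comm]
  have h2 : ∀ k, ∑ j, val (e j : RatFunc ℂ) z * (c k j * G k u) =
      (z : ℂ) ^ (k : ℕ) * G k u / r.denom.eval (z : ℂ) := by
    intro k
    have := hc k z z.2.1
    rw [eval_pow, eval_X] at this
    rw [mul_div_right_comm, ← this, Finset.sum_mul]
    exact Finset.sum_congr rfl fun j _ => by ring
  rw [Finset.sum_congr rfl fun k _ => h2 k, ← Finset.sum_div, h1, mul_div_cancel_left₀ _ hz0]

/-- Interpolation on a single fibre, with no analyticity in u. It covers u = r(∞), where the kernel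
formula must still hold. -/
theorem exists_coefficients_at (hdeg : r.denom.natDegree ≤ r.num.natDegree)
    (hnum : 0 < r.num.natDegree) (e : Module.Basis (Fin (deg r)) ℂ (stateSpace r))
    (F : ℂ → ℂ) (u : ℂ) :
    ∃ g : Fin (deg r) → ℂ, ∀ z : D.domain, val r z = u →
      ∑ k, val (e k : RatFunc ℂ) z * g k = F z := by
  let s := (pencil r u).roots.toFinset
  let f := Lagrange.interpolate s id fun z => r.denom.eval z * F z
  have hf : f ∈ degreeLT ℂ (deg r) := mem_degreeLT.2 <|
    (Lagrange.degree_interpolate_lt _ Function.injective_id.injOn).trans_le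
      (by exact_mod_cast card_roots_pencil_le hdeg u)
  obtain ⟨c, hc⟩ := exists_coeff_of_mem_degreeLT hdeg hnum e hf
  refine ⟨c, fun z hz => ?_⟩
  have hz0 : r.denom.eval (z : ℂ) ≠ 0 := z.2.1
  have hzs : (z : ℂ) ∈ s := by
    rw [Multiset.mem_toFinset, mem_roots (pencil_ne_zero hnum u), IsRoot, ← hz]
    exact eval_pencil_val z
  have h1 : f.eval (z : ℂ) = r.denom.eval (z : ℂ) * F z :=
    Lagrange.eval_interpolate_at_node (v := id) _ Function.injective_id.injOn hzs
  rw [hc z z.2.1, h1, mul_div_cancel_left₀ _ hz0]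

theorem coefficients_unique (hdeg : r.denom.natDegree ≤ r.num.natDegree)
    (hnum : 0 < r.num.natDegree) (e : Module.Basis (Fin (deg r)) ℂ (stateSpace r))
    {u : ℂ} (hu : u ∈ D.finiteA)
    (hus : ¬ ∃ z, (pencil r u).eval z = 0 ∧ (derivative (pencil r u)).eval z = 0)
    {c : Fin (deg r) → ℂ}
    (h : ∀ z : D.domain, val r z = u → ∑ k, val (e k : RatFunc ℂ) z * c k = 0) : c = 0 := by
  have hroot : ∀ z ∈ (pencil r u).roots.toFinset, (pencil r u).eval z = 0 := fun z hz => by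
    rwa [Multiset.mem_toFinset, mem_roots (pencil_ne_zero hnum u), IsRoot] at hz
  refine eq_zero_of_sum_val_eq_zero hdeg hnum e (s := (pencil r u).roots.toFinset)
    (by rw [card_roots_pencil hus]; exact hu.2.ge)
    (fun z hz => (eval_pencil_eq_zero_iff.1 (hroot z hz)).1) fun z hz => ?_
  exact h ⟨z, mem_domain_of_eval_pencil hu.1 (hroot z hz)⟩ (eval_pencil_eq_zero_iff.1 (hroot z hz)).2

/-- A function `F` that is analytic on `r⁻¹(A(r))` has the form `Z_r(z) G(r(z))`, with `G` analytic
in `A(r) \ {r(∞)}`. -/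
theorem exists_analytic_coefficients (hdeg : r.denom.natDegree ≤ r.num.natDegree)
    (hnum : 0 < r.num.natDegree) (e : Module.Basis (Fin (deg r)) ℂ (stateSpace r))
    {F : ℂ → ℂ} (hF : AnalyticOnNhd ℂ F D.domain) :
    ∃ G : Fin (deg r) → ℂ → ℂ, (∀ k, AnalyticOnNhd ℂ (G k) D.finiteA) ∧
      ∀ z : D.domain, ∑ k, val (e k : RatFunc ℂ) z * G k (val r z) = F z := by
  classical
  choose g hg using exists_coefficients_at (D := D) hdeg hnum e F
  -- The arbitrary choice `g` is forced at values without multiple roots. These fill a punctured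
  -- neighbourhood of each point, so the limit recovers every local analytic solution, also at the
  -- exceptional values in `finiteA`.
  let G : Fin (deg r) → ℂ → ℂ := fun k u =>
    if u ∈ D.finiteA then limUnder (𝓝[≠] u) (fun v => g v k) else g u k
  have key : ∀ u₀ ∈ D.finiteA, ∃ H : Fin (deg r) → ℂ → ℂ, (∀ k, AnalyticAt ℂ (H k) u₀) ∧
      (∀ᶠ u in 𝓝 u₀, ∀ k, G k u = H k u) ∧
      ∀ z : D.domain, val r z = u₀ → ∑ k, val (e k : RatFunc ℂ) z * H k u₀ = F z := by
    intro u₀ hu₀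
    obtain ⟨H, hH, hHz⟩ := exists_local_coefficients hdeg hnum e hF hu₀
    refine ⟨H, hH, ?_, hHz.self_of_nhds⟩
    have hev : ∀ᶠ u in 𝓝 u₀, u ∈ D.finiteA ∧ (∀ k, AnalyticAt ℂ (H k) u) ∧
        ∀ z : D.domain, val r z = u → ∑ k, val (e k : RatFunc ℂ) z * H k u = F z :=
      ((isOpen_finiteA hdeg hnum).eventually_mem hu₀).and
        ((eventually_all.2 fun k => (hH k).eventually_analyticAt).and hHz)
    filter_upwards [hev.eventually_nhds] with u hu k
    have h1 : ∀ᶠ v in 𝓝[≠] u, H k v = g v k := by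
      have hb : ∀ᶠ v in 𝓝[≠] u, v ∉ {u | ∃ z, (pencil r u).eval z = 0 ∧
          (derivative (pencil r u)).eval z = 0} :=
        eventually_notMem_of_finite (finite_not_separable hnum) u
      filter_upwards [hu.filter_mono nhdsWithin_le_nhds, hb] with v hv hvb
      have : (fun k => H k v - g v k) = 0 := by
        refine coefficients_unique hdeg hnum e hv.1 hvb fun z hz => ?_
        simp_rw [mul_sub]
        rw [Finset.sum_sub_distrib, hv.2.2 z hz, hg v z hz, sub_self]
      exact sub_eq_zero.1 (congrFun this k)
    have h2 : Tendsto (fun v => g v k) (𝓝[≠] u) (𝓝 (H k u)) :=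
      (((hu.self_of_nhds.2.1 k).continuousAt.tendsto).mono_left nhdsWithin_le_nhds).congr' h1
    simp only [G]
    rw [if_pos hu.self_of_nhds.1, h2.limUnder_eq]
  refine ⟨G, fun k u hu => ?_, fun z => ?_⟩
  · obtain ⟨H, hH, hGH, -⟩ := key u hu
    exact (hH k).congr (hGH.mono fun v hv => (hv k).symm)
  · by_cases hz : val r z ∈ D.finiteA
    · obtain ⟨H, -, hGH, hHz⟩ := key _ hz
      rw [← hHz z rfl]
      exact Finset.sum_congr rfl fun k _ => by rw [hGH.self_of_nhds k]
    · simp only [G, if_neg hz]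
      exact hg _ z rfl

end

end RationalPontryagin

namespace RationalPontryagin

noncomputable section

variable {r : RatFunc ℂ} {D : DiskSystem r} {p : ℕ} (P : RKPontryaginSpace D.domain p)

/-! ### The reproducing kernels of the subspaces of functions vanishing on a fibre -/

/-- The function `K(·, w) c`. -/
def kernelFun (w : D.domain) (c : Fin p → ℂ) : P.carrier :=
  ⟨fun z => P.kernel z w *ᵥ c, P.kernel_mem w c⟩

theorem form_kernelFun (f : P.carrier) (w : D.domain) (c : Fin p → ℂ) :
    P.form f (kernelFun P w c) = star c ⬝ᵥ f.1 w := P.reproducing f w c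

theorem conjTranspose_kernel (z w : D.domain) : (P.kernel z w)ᴴ = P.kernel w z := by
  ext j i
  have h := P.isPontryagin.hermitian (kernelFun P w (Pi.single j 1)) (kernelFun P z (Pi.single i 1))
  rw [form_kernelFun, form_kernelFun] at h
  have h2 : ∀ (k l : Fin p) (x y : D.domain),
      star (Pi.single k (1 : ℂ)) ⬝ᵥ (kernelFun P y (Pi.single l 1)).1 x = P.kernel x y k l := by
    intro k l x y
    rw [← Pi.single_star]
    simp [kernelFun]
  rw [h2, h2] at h
  rw [Matrix.conjTranspose_apply, h]
  rfl

/-- The block row `(K(z, a_1), …, K(z, a_N))`. -/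
def kernelRow (a : Fin (deg r) → D.domain) (z : D.domain) :
    Matrix (Fin p) (Fin (deg r) × Fin p) ℂ :=
  Matrix.of fun i y => P.kernel z (a y.1) i y.2

theorem isHermitian_gram (a : Fin (deg r) → D.domain) : (gram P a).IsHermitian := by
  ext x y
  have := congrFun (congrFun (conjTranspose_kernel P (a y.1) (a x.1)) x.2) y.2
  simpa [gram] using this

/-- The kernel of the subspace of functions that vanish at the points `a_1, …, a_N`. -/
def reducedKernel (a : Fin (deg r) → D.domain) (z w : D.domain) : Matrix (Fin p) (Fin p) ℂ :=
  P.kernel z w - kernelRow P a z * (gram P a)⁻¹ * (kernelRow P a w)ᴴ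

theorem conjTranspose_reducedKernel (a : Fin (deg r) → D.domain) (z w : D.domain) :
    (reducedKernel P a z w)ᴴ = reducedKernel P a w z := by
  rw [reducedKernel, reducedKernel, Matrix.conjTranspose_sub, conjTranspose_kernel,
    Matrix.conjTranspose_mul, Matrix.conjTranspose_mul, Matrix.conjTranspose_conjTranspose,
    Matrix.conjTranspose_nonsing_inv, (isHermitian_gram P a).eq, Matrix.mul_assoc]

theorem reducedKernel_eq_zero (a : Fin (deg r) → D.domain) (hu : IsUnit (gram P a))
    (n : Fin (deg r)) (w : D.domain) : reducedKernel P a (a n) w = 0 := by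
  ext i j
  have h : (kernelRow P a (a n) * (gram P a)⁻¹ * (kernelRow P a w)ᴴ) i j =
      (gram P a * ((gram P a)⁻¹ * (kernelRow P a w)ᴴ)) (n, i) j := by
    rw [Matrix.mul_assoc]
    rfl
  rw [reducedKernel, Matrix.sub_apply, h,
    Matrix.mul_nonsing_inv_cancel_left _ _ ((Matrix.isUnit_iff_isUnit_det _).1 hu),
    ← conjTranspose_kernel]
  simp [kernelRow]

/-- The function `z ↦ reducedKernel z w * c`, as an element of the space. -/
def reducedFun (a : Fin (deg r) → D.domain) (w : D.domain) (c : Fin p → ℂ) : P.carrier :=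
  kernelFun P w c - ∑ y : Fin (deg r) × Fin p,
    (((gram P a)⁻¹ * (kernelRow P a w)ᴴ) *ᵥ c) y • kernelFun P (a y.1) (Pi.single y.2 1)

theorem reducedFun_apply (a : Fin (deg r) → D.domain) (w : D.domain) (c : Fin p → ℂ)
    (z : D.domain) : (reducedFun P a w c).1 z = reducedKernel P a z w *ᵥ c := by
  have h : (∑ y : Fin (deg r) × Fin p, (((gram P a)⁻¹ * (kernelRow P a w)ᴴ) *ᵥ c) y •
      kernelFun P (a y.1) (Pi.single y.2 1)).1 z =
      kernelRow P a z *ᵥ (((gram P a)⁻¹ * (kernelRow P a w)ᴴ) *ᵥ c) := by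
    rw [Submodule.coe_sum, Finset.sum_apply]
    ext i
    rw [Finset.sum_apply, Matrix.mulVec, dotProduct]
    refine Finset.sum_congr rfl fun y _ => ?_
    simp [kernelFun, kernelRow, mul_comm]
  rw [reducedFun, Submodule.coe_sub, Pi.sub_apply, h, reducedKernel, Matrix.sub_mulVec,
    Matrix.mul_assoc, Matrix.mulVec_mulVec]
  rfl

variable {α : ℂ} {a : Fin (deg r) → D.domain}

theorem vanishesOver_reducedFun (hdeg : r.denom.natDegree ≤ r.num.natDegree)
    (hnum : 0 < r.num.natDegree) (ha : IsFibre α a) (hu : IsUnit (gram P a))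
    (w : D.domain) (c : Fin p → ℂ) : VanishesOver P α (reducedFun P a w c) := by
  intro z hz
  obtain ⟨n, rfl⟩ := exists_eq_fibre hdeg hnum ha hz
  rw [reducedFun_apply, reducedKernel_eq_zero P a hu, Matrix.zero_mulVec]

/-- The subtracted terms are kernel functions at points of the fibre, hence orthogonal to any f
vanishing there. -/
theorem form_reducedFun (ha : IsFibre α a) {f : P.carrier} (hf : VanishesOver P α f)
    (w : D.domain) (c : Fin p → ℂ) : P.form f (reducedFun P a w c) = star c ⬝ᵥ f.1 w := by
  rw [reducedFun, map_sub, map_sum, form_kernelFun, Finset.sum_eq_zero, sub_zero]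
  intro y _
  rw [LinearMap.map_smulₛₗ, form_kernelFun, hf _ (ha.2 y.1), dotProduct_zero, smul_zero]

theorem eq_of_forall_dotProduct {A B : Matrix (Fin p) (Fin p) ℂ}
    (h : ∀ c d : Fin p → ℂ, star d ⬝ᵥ (A *ᵥ c) = star d ⬝ᵥ (B *ᵥ c)) : A = B := by
  ext i j
  have := h (Pi.single j 1) (Pi.single i 1)
  rw [← Pi.single_star] at this
  simpa using this

variable {β : ℂ} {b : Fin (deg r) → D.domain} {m m' : ℂ → ℂ}

/-- Surjectivity of the isometry: by `hm` and `hm'` the multipliers m/(r - α) and m'/(r - β) have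
the constant product κ'/κ, so one inverts the other up to the factor κ/κ'. -/
theorem exists_preimage (hαβ : α ≠ β) {κ κ' : ℂ} (hκ' : κ' ≠ 0) (hm : ∀ s, s - β = κ * m s)
    (hm' : ∀ s, m' s = κ' * (s - α)) (h : IsIsometricMultiplier P m' β) {g : P.carrier}
    (hg : VanishesOver P β g) : ∃ k, VanishesOver P α k ∧ IsProduct P m α k g := by
  obtain ⟨k, hk⟩ := h.1 g hg
  refine ⟨(κ / κ') • k, fun z hz => ?_, fun z => ?_⟩
  · have := hk z
    rw [hm', hz, sub_self, mul_zero, zero_smul] at this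
    have hk0 := (smul_eq_zero.1 this).resolve_left (sub_ne_zero.2 hαβ)
    simp [hk0]
  · have := hk z
    rw [hm, hm', mul_smul, mul_smul] at this
    simp only [Submodule.coe_smul, Pi.smul_apply]
    rw [div_eq_inv_mul, mul_smul, smul_comm (m _), smul_comm (m _), this, inv_smul_smul₀ hκ']

/-- The isometry between the subspaces of functions that vanish over `α` and over `β`, in terms of
their reproducing kernels. -/
theorem smul_reducedKernel (hdeg : r.denom.natDegree ≤ r.num.natDegree)
    (hnum : 0 < r.num.natDegree) (ha : IsFibre α a) (hb : IsFibre β b)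
    (hua : IsUnit (gram P a)) (hub : IsUnit (gram P b))
    (hαβ : α ≠ β) {κ κ' : ℂ} (hκ : κ ≠ 0) (hκ' : κ' ≠ 0) (hm : ∀ s, s - β = κ * m s)
    (hm' : ∀ s, m' s = κ' * (s - α)) (h : IsIsometricMultiplier P m α)
    (h' : IsIsometricMultiplier P m' β) (z w : D.domain) :
    (m (val r z) * conj (m (val r w))) • reducedKernel P a z w =
      ((val r z - α) * conj (val r w - α)) • reducedKernel P b z w := by
  refine eq_of_forall_dotProduct fun c d => ?_
  have hf := vanishesOver_reducedFun P hdeg hnum ha hua w c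
  have hg := vanishesOver_reducedFun P hdeg hnum hb hub z d
  -- Here g is the image of f = K_α(·,w)c, and k is the preimage of K_β(·,z)d. The isometry [f, k] =
  -- [g, K_β(·,z)d], evaluated by the reproducing property on both sides, is the claim before
  -- clearing denominators.
  obtain ⟨g, hfg⟩ := h.1 _ hf
  obtain ⟨k, hk, hkg⟩ := exists_preimage P hαβ hκ' hm hm' h' hg
  have hgβ : VanishesOver P β g := by
    intro x hx
    have h1 := hfg x
    have h2 : m β = 0 := by
      have := hm β
      rw [sub_self, eq_comm, mul_eq_zero] at this
      exact this.resolve_left hκ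
    rw [hx, h2, zero_smul] at h1
    exact (smul_eq_zero.1 h1).resolve_left (sub_ne_zero.2 hαβ.symm)
  have hiso := h.2 _ _ _ _ hf hk hfg hkg
  rw [form_reducedFun P hb hgβ, P.isPontryagin.hermitian, form_reducedFun P ha hk] at hiso
  have h1 := hfg z
  have h2 := hkg w
  rw [reducedFun_apply] at h1 h2
  have h3 : star d ⬝ᵥ (reducedKernel P b z w *ᵥ c) =
      conj (star c ⬝ᵥ (reducedKernel P b w z *ᵥ d)) := by
    rw [← conjTranspose_reducedKernel P b w z, starRingEnd_apply, ← Matrix.star_dotProduct_star]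
    rw [star_star, Matrix.star_mulVec, Matrix.dotProduct_mulVec]
  rw [Matrix.smul_mulVec, Matrix.smul_mulVec, dotProduct_smul, dotProduct_smul, h3]
  have h4 := congrArg (fun v => star d ⬝ᵥ v) h1
  have h5 := congrArg (fun v => conj (star c ⬝ᵥ v)) h2
  simp only [dotProduct_smul, smul_eq_mul, map_mul] at h4 h5 ⊢
  linear_combination -conj (m (val r w)) * h4 - (val r z - α) * h5 +
    conj (m (val r w)) * (val r z - α) * hiso.symm

end

end RationalPontryagin

namespace RationalPontryagin

noncomputable section

/-! ### Signatures -/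

theorem ncard_setOf_comp {n : Type*} [Fintype n] (f : n → ℝ) (q : ℝ → Prop) [DecidablePred q] :
    {i | q (f i)}.ncard = (Multiset.map f Finset.univ.val).countP q := by
  classical
  rw [Multiset.countP_map, Set.ncard_eq_toFinset_card' {i | q (f i)}]
  simp [Finset.card, Finset.filter]

theorem exists_signature_factorization {n : Type*} [Fintype n] [DecidableEq n]
    {H : Matrix n n ℂ} (hH : H.IsHermitian) (hu : IsUnit H) :
    ∃ J S : Matrix n n ℂ, IsSignatureMatrix J ∧ SameSignature J H ∧ H⁻¹ = S * J * Sᴴ := by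
  set l := hH.eigenvalues with hl
  have hl0 : ∀ i, l i ≠ 0 := by
    have hdet := ((Matrix.isUnit_iff_isUnit_det _).1 hu).ne_zero
    rw [hH.det_eq_prod_eigenvalues, Finset.prod_ne_zero_iff] at hdet
    exact fun i => by simpa using hdet i (Finset.mem_univ i)
  set σ : n → ℝ := fun i => SignType.sign (l i) with hσ
  have hσl : ∀ i, σ i * σ i = 1 := fun i => by
    rcases lt_or_gt_of_ne (hl0 i) with h | h <;> simp [hσ, h]
  have hpos : ∀ i, 0 < σ i ↔ 0 < l i := fun i => by
    rcases lt_or_gt_of_ne (hl0 i) with h | h <;> norm_num [hσ, h, h.le]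
  have hneg : ∀ i, σ i < 0 ↔ l i < 0 := fun i => by
    rcases lt_or_gt_of_ne (hl0 i) with h | h <;> norm_num [hσ, h, h.le]
  let J : Matrix n n ℂ := Matrix.diagonal fun i => (σ i : ℂ)
  have hJ : J.IsHermitian := by
    refine Matrix.isHermitian_diagonal_of_self_adjoint _ ?_
    ext i; simp
  -- The order in which `eigenvalues` lists the diagonal of J is not known; the characteristic
  -- polynomial determines it as a multiset, which is enough for counting signs.
  have hmap : Multiset.map hJ.eigenvalues Finset.univ.val = Multiset.map σ Finset.univ.val := by
    have h1 := hJ.roots_charpoly_eq_eigenvalues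
    rw [Matrix.charpoly_diagonal, Polynomial.roots_prod _ _
      (Finset.prod_ne_zero_iff.2 fun i _ => Polynomial.X_sub_C_ne_zero _)] at h1
    have h2 : Multiset.map ((↑) : ℝ → ℂ) (Multiset.map hJ.eigenvalues Finset.univ.val) =
        Multiset.map ((↑) : ℝ → ℂ) (Multiset.map σ Finset.univ.val) := by
      rw [Multiset.map_map, Multiset.map_map]
      simpa using h1.symm
    exact Multiset.map_injective Complex.ofReal_injective h2
  let U : Matrix n n ℂ := hH.eigenvectorUnitary
  have hU : Uᴴ * U = 1 := by
    have := Unitary.coe_star_mul_self hH.eigenvectorUnitary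
    simpa [Matrix.star_eq_conjTranspose] using this
  have hHU : H = U * Matrix.diagonal (fun i => (l i : ℂ)) * Uᴴ := by
    conv_lhs => rw [hH.spectral_theorem]
    rfl
  have hU' : U * Uᴴ = 1 := mul_eq_one_comm.1 hU
  let T : Matrix n n ℂ := Matrix.diagonal fun i => ((Real.sqrt |l i|)⁻¹ : ℝ)
  have hT : Tᴴ = T := by
    simp only [T, Matrix.diagonal_conjTranspose]
    congr 1; ext i; simp
  have hTJ : T * J * T = Matrix.diagonal fun i => (l i : ℂ)⁻¹ := by
    simp only [T, J, Matrix.diagonal_mul_diagonal]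
    congr 1; ext i
    rw [← Complex.ofReal_mul, ← Complex.ofReal_mul, ← Complex.ofReal_inv]
    congr 1
    rw [mul_right_comm, ← mul_inv, Real.mul_self_sqrt (abs_nonneg _)]
    rcases lt_or_gt_of_ne (hl0 i) with h | h
    · simp [hσ, h, abs_of_neg h, inv_neg]
    · simp [hσ, h, abs_of_pos h]
  refine ⟨J, U * T, ⟨hJ, ?_⟩, ⟨hJ, hH, ?_, ?_⟩, ?_⟩
  · simp only [J, Matrix.diagonal_mul_diagonal, ← Complex.ofReal_mul, hσl]
    simp
  · rw [ncard_setOf_comp _ (0 < ·), hmap, ← ncard_setOf_comp]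
    simp only [hpos, hl]
  · rw [ncard_setOf_comp _ (· < 0), hmap, ← ncard_setOf_comp]
    simp only [hneg, hl]
  · refine Matrix.inv_eq_left_inv ?_
    rw [Matrix.conjTranspose_mul, hT]
    calc U * T * J * (T * Uᴴ) * H = U * (T * J * T) * (Uᴴ * H) := by simp only [Matrix.mul_assoc]
      _ = U * ((T * J * T) * Matrix.diagonal (fun i => (l i : ℂ))) * Uᴴ := by
        rw [hHU]
        simp only [← Matrix.mul_assoc]
        rw [Matrix.mul_assoc _ Uᴴ U, hU, Matrix.mul_one]
      _ = 1 := by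
        rw [hTJ, Matrix.diagonal_mul_diagonal]
        simp [hl0, hU']

/-! ### Removing a point from a connected open set -/

open Filter Topology Metric

/-- The punctured disk is the image of a half-plane under w ↦ c + exp w. -/
theorem isPreconnected_ball_diff_center (c : ℂ) (ε : ℝ) : IsPreconnected (ball c ε \ {c}) := by
  rcases le_or_gt ε 0 with hε | hε
  · rw [ball_eq_empty.2 hε, Set.empty_sdiff]
    exact isPreconnected_empty
  have : ball c ε \ {c} = (fun w => c + Complex.exp w) '' {w | w.re < Real.log ε} := by
    ext z
    simp only [Set.mem_sdiff, mem_ball, Set.mem_singleton_iff, Set.mem_image, dist_eq_norm]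
    constructor
    · rintro ⟨h1, h2⟩
      have h3 : z - c ≠ 0 := sub_ne_zero.2 h2
      refine ⟨Complex.log (z - c), ?_, by rw [Complex.exp_log h3]; ring⟩
      show (Complex.log (z - c)).re < _
      rw [Complex.log_re]
      exact Real.log_lt_log (norm_pos_iff.2 h3) h1
    · rintro ⟨w, hw, rfl⟩
      refine ⟨?_, by simp⟩
      rw [add_sub_cancel_left, Complex.norm_exp]
      exact (Real.lt_log_iff_exp_lt hε).1 hw
  rw [this]
  exact (convex_halfSpace_re_lt _).isPreconnected.image _ (by fun_prop)

/-- In a separation of the punctured set, a small punctured disk around c lies on one side. Adding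
the full disk to that side would separate U itself. -/
theorem _root_.IsPreconnected.diff_singleton_complex {U : Set ℂ} (hU : IsPreconnected U)
    (hUo : IsOpen U) (c : ℂ) : IsPreconnected (U \ {c}) := by
  by_cases hc : c ∈ U
  swap
  · rwa [Set.sdiff_singleton_eq_self hc]
  obtain ⟨ε, hε, hball⟩ := Metric.isOpen_iff.1 hUo c hc
  have main : ∀ u v : Set ℂ, IsOpen u → IsOpen v → U \ {c} ⊆ u ∪ v → U \ {c} ∩ (u ∩ v) = ∅ →
      ball c ε \ {c} ⊆ u → U \ {c} ⊆ u := by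
    intro u v hu hv huv hd hb
    have hor := isPreconnected_iff_subset_of_disjoint.1 hU (u ∪ ball c ε) (v \ {c})
      (hu.union isOpen_ball) (hv.sdiff isClosed_singleton) ?_ ?_
    · rcases hor with h | h
      · intro z hz
        rcases h hz.1 with h1 | h1
        · exact h1
        · exact hb ⟨h1, hz.2⟩
      · exact absurd rfl (h hc).2
    · intro z hz
      by_cases hzc : z = c
      · subst hzc; exact Or.inl (Or.inr (mem_ball_self hε))
      · rcases huv ⟨hz, hzc⟩ with h | h
        · exact Or.inl (Or.inl h)
        · exact Or.inr ⟨h, hzc⟩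
    · rw [Set.eq_empty_iff_forall_notMem] at hd ⊢
      rintro z ⟨hz, h1, h2⟩
      refine hd z ⟨⟨hz, h2.2⟩, ?_, h2.1⟩
      rcases h1 with h1 | h1
      · exact h1
      · exact hb ⟨h1, h2.2⟩
  rw [isPreconnected_iff_subset_of_disjoint]
  intro u v hu hv huv hd
  have hbU : ball c ε \ {c} ⊆ U \ {c} := Set.sdiff_subset_sdiff_left hball
  rcases isPreconnected_iff_subset_of_disjoint.1 (isPreconnected_ball_diff_center c ε) u v hu hv
    (hbU.trans huv) (Set.subset_empty_iff.1 (hd ▸ Set.inter_subset_inter_left _ hbU)) with h | h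
  · exact Or.inl (main u v hu hv huv hd h)
  · exact Or.inr (main v u hv hu (by rwa [Set.union_comm]) (by rwa [Set.inter_comm v u]) h)

end

end RationalPontryagin

namespace RationalPontryagin

noncomputable section

open Filter Topology

variable {r : RatFunc ℂ} {D : DiskSystem r} {p : ℕ} (P : RKPontryaginSpace D.domain p)

/-! ### Factorization of the block rows -/

theorem ZI_mul_apply (e : Module.Basis (Fin (deg r)) ℂ (stateSpace r)) {ι : Type*} (z : ℂ)
    (X : Matrix (Fin (deg r) × Fin p) ι ℂ) (i : Fin p) (y : ι) :
    (ZI e p z * X) i y = ∑ k, val (e k : RatFunc ℂ) z * X (k, i) y := by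
  rw [Matrix.mul_apply, Fintype.sum_prod_type]
  refine Finset.sum_congr rfl fun k _ => ?_
  rw [Finset.sum_eq_single i]
  · simp [ZI]
  · intro j _ hj
    simp [ZI, Matrix.one_apply_ne hj.symm]
  · simp

theorem exists_kernelRow_factor (hdeg : r.denom.natDegree ≤ r.num.natDegree)
    (hnum : 0 < r.num.natDegree) (e : Module.Basis (Fin (deg r)) ℂ (stateSpace r))
    (hP : P.IsAnalytic) (a : Fin (deg r) → D.domain) :
    ∃ E : ℂ → Matrix (Fin (deg r) × Fin p) (Fin (deg r) × Fin p) ℂ,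
      (∀ i j, AnalyticOnNhd ℂ (fun u => E u i j) D.finiteA) ∧
      ∀ z : D.domain, ZI e p z * E (val r z) = kernelRow P a z := by
  have h : ∀ (i : Fin p) (y : Fin (deg r) × Fin p), ∃ G : Fin (deg r) → ℂ → ℂ,
      (∀ k, AnalyticOnNhd ℂ (G k) D.finiteA) ∧ ∀ z : D.domain,
        ∑ k, val (e k : RatFunc ℂ) z * G k (val r z) = kernelRow P a z i y := by
    intro i y
    obtain ⟨F, hF, hFz⟩ := hP _ (P.kernel_mem (a y.1) (Pi.single y.2 1))
    obtain ⟨G, hG, hGz⟩ := exists_analytic_coefficients hdeg hnum e (F := fun z => F z i)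
      fun z hz => (analyticAt_pi_iff.1 (hF z hz)) i
    refine ⟨G, hG, fun z => ?_⟩
    rw [hGz z, hFz z]
    simp [kernelRow]
  choose G hG hGz using h
  refine ⟨fun u => Matrix.of fun x y => G x.2 y x.1 u, fun x y => hG x.2 y x.1, fun z => ?_⟩
  ext i y
  rw [ZI_mul_apply]
  exact hGz i y z

theorem ZI_mul_cancel (hdeg : r.denom.natDegree ≤ r.num.natDegree)
    (hnum : 0 < r.num.natDegree) (e : Module.Basis (Fin (deg r)) ℂ (stateSpace r))
    {u : ℂ} (hu : u ∈ D.finiteA)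
    (hus : ¬ ∃ z, (pencil r u).eval z = 0 ∧ (Polynomial.derivative (pencil r u)).eval z = 0)
    {ι : Type*} {X : Matrix (Fin (deg r) × Fin p) ι ℂ}
    (h : ∀ z : D.domain, val r z = u → ZI e p z * X = 0) : X = 0 := by
  ext x y
  have : (fun k => X (k, x.2) y) = 0 := by
    refine coefficients_unique hdeg hnum e hu hus fun z hz => ?_
    rw [← ZI_mul_apply e (z : ℂ) X x.2 y, h z hz]
    rfl
  exact congrFun this x.1

/-- Cancel Z_r on each side in turn, letting z and w run independently through the fibre. -/
theorem ZI_mul_mul_cancel (hdeg : r.denom.natDegree ≤ r.num.natDegree)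
    (hnum : 0 < r.num.natDegree) (e : Module.Basis (Fin (deg r)) ℂ (stateSpace r))
    {u : ℂ} (hu : u ∈ D.finiteA)
    (hus : ¬ ∃ z, (pencil r u).eval z = 0 ∧ (Polynomial.derivative (pencil r u)).eval z = 0)
    {X : Matrix (Fin (deg r) × Fin p) (Fin (deg r) × Fin p) ℂ}
    (h : ∀ z w : D.domain, val r z = u → val r w = u → ZI e p z * X * (ZI e p w)ᴴ = 0) :
    X = 0 := by
  rw [← Matrix.conjTranspose_eq_zero]
  refine ZI_mul_cancel hdeg hnum e hu hus fun w hw => ?_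
  rw [← Matrix.conjTranspose_eq_zero, Matrix.conjTranspose_mul, Matrix.conjTranspose_conjTranspose]
  refine ZI_mul_cancel hdeg hnum e hu hus fun z hz => ?_
  rw [← Matrix.mul_assoc]
  exact h z w hz hw

/-- Stacking the rows Z_r(a_n) ⊗ I_p gives a square matrix whose product with E is the invertible
Gram matrix. -/
theorem det_factor_ne_zero (e : Module.Basis (Fin (deg r)) ℂ (stateSpace r)) {α : ℂ}
    {a : Fin (deg r) → D.domain} (ha : IsFibre α a) (hu : IsUnit (gram P a))
    {E : Matrix (Fin (deg r) × Fin p) (Fin (deg r) × Fin p) ℂ}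
    (hE : ∀ z : D.domain, val r z = α → ZI e p z * E = kernelRow P a z) : E.det ≠ 0 := by
  have h : (Matrix.of fun x : Fin (deg r) × Fin p => ZI e p (a x.1) x.2) * E = gram P a := by
    ext x y
    exact congrFun (congrFun (hE (a x.1) (ha.2 x.1)) x.2) y
  have h1 := ((Matrix.isUnit_iff_isUnit_det _).1 hu).ne_zero
  rw [← h, Matrix.det_mul] at h1
  exact right_ne_zero_of_mul h1

/-! ### The points at which the two sides of the kernel identity balance -/

theorem analyticOnNhd_det {n : Type*} [Fintype n] [DecidableEq n] {S : Set ℂ}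
    {E : ℂ → Matrix n n ℂ} (hE : ∀ i j, AnalyticOnNhd ℂ (fun u => E u i j) S) :
    AnalyticOnNhd ℂ (fun u => (E u).det) S := by
  intro u hu
  simp only [Matrix.det_apply']
  exact Finset.analyticAt_fun_sum _ fun s _ => analyticAt_const.mul
    (Finset.analyticAt_fun_prod _ fun i _ => hE _ _ u hu)

theorem analyticOnNhd_mul_const {n : Type*} [Fintype n] {S : Set ℂ} {E : ℂ → Matrix n n ℂ}
    (hE : ∀ i j, AnalyticOnNhd ℂ (fun u => E u i j) S) (X : Matrix n n ℂ) (i j : n) :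
    AnalyticOnNhd ℂ (fun u => (E u * X) i j) S := by
  intro u hu
  simp only [Matrix.mul_apply]
  exact Finset.analyticAt_fun_sum _ fun k _ => (hE _ _ u hu).mul analyticAt_const

theorem eventually_mem_finiteA (hdeg : r.denom.natDegree ≤ r.num.natDegree)
    (hnum : 0 < r.num.natDegree) {x : ℂ} (hx : x ∈ D.A) : ∀ᶠ u in 𝓝[≠] x, u ∈ D.finiteA := by
  have hA : ∀ᶠ u in 𝓝[≠] x, u ∈ D.A :=
    ((isOpen_A hnum).eventually_mem hx).filter_mono nhdsWithin_le_nhds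
  rcases exists_finiteA_eq_diff (D := D) hdeg hnum with h | ⟨c, h⟩
  · rwa [h]
  · rw [h]
    filter_upwards [hA, eventually_notMem_of_finite (Set.finite_singleton c) x] with u h1 h2
    exact ⟨h1, h2⟩

theorem isPreconnected_inter_finiteA (hdeg : r.denom.natDegree ≤ r.num.natDegree)
    (hnum : 0 < r.num.natDegree) (α : ℂ) :
    IsPreconnected (connectedComponentIn D.A α ∩ D.finiteA) := by
  have hsub := connectedComponentIn_subset D.A α
  rcases exists_finiteA_eq_diff (D := D) hdeg hnum with h | ⟨c, h⟩
  · rw [h, Set.inter_eq_self_of_subset_left hsub]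
    exact isPreconnected_connectedComponentIn
  · rw [h, ← Set.inter_sdiff_assoc, Set.inter_eq_self_of_subset_left hsub]
    exact isPreconnected_connectedComponentIn.diff_singleton_complex
      (isOpen_A hnum).connectedComponentIn c

/-- If an analytic function does not vanish at `α`, then it is nonzero at some simple value in any
perfect set that meets the component of `α`. -/
theorem exists_ne_zero_mem (hdeg : r.denom.natDegree ≤ r.num.natDegree)
    (hnum : 0 < r.num.natDegree) {α : ℂ} (hα : α ∈ D.finiteA) {f : ℂ → ℂ}
    (hf : AnalyticOnNhd ℂ f D.finiteA) (hfα : f α ≠ 0) {T : Set ℂ}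
    (hT : ∀ x ∈ T, ∃ᶠ y in 𝓝[≠] x, y ∈ T) {x₀ : ℂ} (hx₀ : x₀ ∈ connectedComponentIn D.A α)
    (hx₀T : x₀ ∈ T) :
    ∃ x ∈ D.finiteA, x ∈ T ∧ f x ≠ 0 ∧
      ¬ ∃ z, (pencil r x).eval z = 0 ∧ (Polynomial.derivative (pencil r x)).eval z = 0 := by
  by_contra! hc
  have hsub := connectedComponentIn_subset D.A α
  have hopen : IsOpen (connectedComponentIn D.A α) := (isOpen_A hnum).connectedComponentIn
  -- The point `x₀` may be r(∞); perfectness of T supplies a nearby point where f is analytic.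
  obtain ⟨x₁, hx₁T, hx₁, hx₁A⟩ := ((hT x₀ hx₀T).and_eventually
    (((hopen.eventually_mem hx₀).filter_mono nhdsWithin_le_nhds).and
      (eventually_mem_finiteA hdeg hnum (hsub hx₀)))).exists
  refine hfα ((hf.mono Set.inter_subset_right).eqOn_zero_of_preconnected_of_frequently_eq_zero
    (isPreconnected_inter_finiteA hdeg hnum α) ⟨hx₁, hx₁A⟩ ?_
    ⟨mem_connectedComponentIn hα.1, hα⟩)
  refine ((hT x₁ hx₁T).and_eventually ((eventually_mem_finiteA hdeg hnum hx₁A.1).and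
    (eventually_notMem_of_finite (finite_not_separable hnum) x₁))).mono ?_
  rintro y ⟨hyT, hyA, hyb⟩
  by_contra hy
  obtain ⟨z, hz⟩ := hc y hyA hyT hy
  exact hyb ⟨z, hz⟩

/-! ### The kernel formula -/

/-- The common core of both cases: they enter only through m, γ, d and the zero set of d(x,x), which
is the real line or the unit circle. -/
theorem hasKernelForm_of_identity (hdeg : r.denom.natDegree ≤ r.num.natDegree)
    (hnum : 0 < r.num.natDegree) (e : Module.Basis (Fin (deg r)) ℂ (stateSpace r))
    (hP : P.IsAnalytic) {α : ℂ} {a b : Fin (deg r) → D.domain} (ha : IsFibre α a)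
    (hua : IsUnit (gram P a)) {m : ℂ → ℂ} (hm : Differentiable ℂ m) (hmα : m α ≠ 0)
    {d : ℂ → ℂ → ℂ} {γ : ℝ} (hγ : γ ≠ 0)
    (hd : ∀ s t, m s * conj (m t) - (s - α) * conj (t - α) = γ * d s t)
    (hker : ∀ z w : D.domain, (m (val r z) * conj (m (val r w))) • reducedKernel P a z w =
      ((val r z - α) * conj (val r w - α)) • reducedKernel P b z w)
    (hT : ∀ x, d x x = 0 → ∃ᶠ y in 𝓝[≠] x, d y y = 0)
    {x₀ : ℂ} (hx₀ : x₀ ∈ connectedComponentIn D.A α) (hdx₀ : d x₀ x₀ = 0) :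
    HasKernelForm e P d (gram P a) := by
  obtain ⟨Ea, hEa, hEaz⟩ := exists_kernelRow_factor P hdeg hnum e hP a
  obtain ⟨Eb, hEb, hEbz⟩ := exists_kernelRow_factor P hdeg hnum e hP b
  have hαA : α ∈ D.finiteA := mem_finiteA_of_fibre hdeg hnum ha
  obtain ⟨J, S, hJ, hJs, hS⟩ := exists_signature_factorization (isHermitian_gram P a) hua
  let A₁ : ℂ → Matrix (Fin (deg r) × Fin p) (Fin (deg r) × Fin p) ℂ := fun u => m u • Ea u
  let B₁ : ℂ → Matrix (Fin (deg r) × Fin p) (Fin (deg r) × Fin p) ℂ := fun u => (u - α) • Eb u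
  have hA₁ : ∀ i j, AnalyticOnNhd ℂ (fun u => A₁ u i j) D.finiteA := fun i j u hu =>
    (hm.analyticAt u).mul (hEa i j u hu)
  have hB₁ : ∀ i j, AnalyticOnNhd ℂ (fun u => B₁ u i j) D.finiteA := fun i j u hu =>
    (analyticAt_id.sub analyticAt_const).mul (hEb i j u hu)
  have hdetα : (A₁ α).det ≠ 0 := by
    rw [Matrix.det_smul]
    refine mul_ne_zero (pow_ne_zero _ hmα) (det_factor_ne_zero P e ha hua fun z hz => ?_)
    rw [← hz, hEaz]
  have hid : ∀ z w : D.domain, ((γ : ℂ) * d (val r z) (val r w)) • P.kernel z w =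
      ZI e p z * (A₁ (val r z) * (gram P a)⁻¹ * (A₁ (val r w))ᴴ -
        B₁ (val r z) * (gram P b)⁻¹ * (B₁ (val r w))ᴴ) * (ZI e p w)ᴴ := by
    intro z w
    have h1 := hker z w
    simp only [reducedKernel, smul_sub] at h1
    rw [← hd, sub_smul]
    have h2 : ZI e p z * (A₁ (val r z) * (gram P a)⁻¹ * (A₁ (val r w))ᴴ) * (ZI e p w)ᴴ =
        (m (val r z) * conj (m (val r w))) •
          (kernelRow P a z * (gram P a)⁻¹ * (kernelRow P a w)ᴴ) := by
      rw [← hEaz z, ← hEaz w]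
      simp only [A₁, Matrix.conjTranspose_smul, Matrix.conjTranspose_mul, Matrix.smul_mul,
        Matrix.mul_smul, Matrix.mul_assoc, smul_smul, starRingEnd_apply, mul_comm]
    have h3 : ZI e p z * (B₁ (val r z) * (gram P b)⁻¹ * (B₁ (val r w))ᴴ) * (ZI e p w)ᴴ =
        ((val r z - α) * conj (val r w - α)) •
          (kernelRow P b z * (gram P b)⁻¹ * (kernelRow P b w)ᴴ) := by
      rw [← hEbz z, ← hEbz w]
      simp only [B₁, Matrix.conjTranspose_smul, Matrix.conjTranspose_mul, Matrix.smul_mul,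
        Matrix.mul_smul, Matrix.mul_assoc, smul_smul, starRingEnd_apply, mul_comm]
    rw [Matrix.mul_sub, Matrix.sub_mul, h2, h3]
    rw [sub_eq_sub_iff_add_eq_add] at h1 ⊢
    rw [h1, add_comm]
  obtain ⟨x, hxA, hxd, hxdet, hxs⟩ := exists_ne_zero_mem hdeg hnum hαA (analyticOnNhd_det hA₁)
    hdetα (T := {x | d x x = 0}) hT hx₀ hdx₀
  have hbal : A₁ x * (gram P a)⁻¹ * (A₁ x)ᴴ = B₁ x * (gram P b)⁻¹ * (B₁ x)ᴴ := by
    rw [← sub_eq_zero]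
    refine ZI_mul_mul_cancel hdeg hnum e hxA hxs fun z w hz hw => ?_
    have := hid z w
    rw [hz, hw, show d x x = 0 from hxd, mul_zero, zero_smul] at this
    exact this.symm
  -- The left side of `hbal` is invertible, so the right side is too; invertibility of B₁(x) is thus
  -- inherited from A₁(x).
  have hBdet : IsUnit (B₁ x).det := by
    have h1 := congrArg Matrix.det hbal
    have h2 : ((gram P a)⁻¹).det ≠ 0 :=
      (Matrix.isUnit_nonsing_inv_det _ ((Matrix.isUnit_iff_isUnit_det _).1 hua)).ne_zero
    simp only [Matrix.det_mul, Matrix.det_conjTranspose] at h1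
    refine isUnit_iff_ne_zero.2 fun h0 => ?_
    rw [h0, zero_mul, zero_mul] at h1
    exact mul_ne_zero (mul_ne_zero hxdet h2) (star_ne_zero.2 hxdet) h1
  clear_value A₁ B₁
  -- The constant matrix C carries the inverse Gram matrix at α to the one at the reflected point,
  -- so a single J serves both terms.
  set C := (B₁ x)⁻¹ * A₁ x with hC
  have hHb : (gram P b)⁻¹ = C * (gram P a)⁻¹ * Cᴴ := by
    have hBdet' : IsUnit (B₁ x)ᴴ.det := by
      rw [Matrix.det_conjTranspose]; exact hBdet.star
    calc (gram P b)⁻¹ = (B₁ x)⁻¹ * (B₁ x * (gram P b)⁻¹ * (B₁ x)ᴴ) * ((B₁ x)ᴴ)⁻¹ := by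
          rw [Matrix.mul_assoc (B₁ x), Matrix.nonsing_inv_mul_cancel_left _ _ hBdet,
            Matrix.mul_nonsing_inv_cancel_right _ _ hBdet']
      _ = C * (gram P a)⁻¹ * Cᴴ := by
          rw [← hbal, hC, Matrix.conjTranspose_mul, Matrix.conjTranspose_nonsing_inv]
          simp only [Matrix.mul_assoc]
  have hid' : ∀ z w : D.domain, d (val r z) (val r w) • P.kernel z w =
      (γ : ℂ)⁻¹ • (ZI e p z * ((A₁ (val r z) * S) * J * (A₁ (val r w) * S)ᴴ -
        (B₁ (val r z) * (C * S)) * J * (B₁ (val r w) * (C * S))ᴴ) * (ZI e p w)ᴴ) := by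
    intro z w
    have hγ' : (γ : ℂ) ≠ 0 := by exact_mod_cast hγ
    rw [eq_inv_smul_iff₀ hγ', smul_smul, hid z w, hHb, hS]
    simp only [Matrix.conjTranspose_mul, Matrix.mul_assoc]
  have hsqrt : ∀ δ : ℝ, 0 < δ → (((Real.sqrt δ)⁻¹ : ℝ) : ℂ) * (((Real.sqrt δ)⁻¹ : ℝ) : ℂ) =
      (δ : ℂ)⁻¹ := fun δ hδ => by
    rw [← Complex.ofReal_mul, ← mul_inv, Real.mul_self_sqrt hδ.le, Complex.ofReal_inv]
  have hscale : ∀ (c : ℝ) (X Y : Matrix (Fin (deg r) × Fin p) (Fin (deg r) × Fin p) ℂ),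
      ((c : ℂ) • X) * J * ((c : ℂ) • Y)ᴴ = ((c : ℂ) * c) • (X * J * Yᴴ) := by
    intro c X Y
    simp only [Matrix.conjTranspose_smul, Complex.star_def, Complex.conj_ofReal, Matrix.smul_mul,
      Matrix.mul_smul, smul_smul]
  have han : ∀ (c : ℂ) {E : ℂ → Matrix (Fin (deg r) × Fin p) (Fin (deg r) × Fin p) ℂ}
      (_ : ∀ i j, AnalyticOnNhd ℂ (fun u => E u i j) D.finiteA)
      (X : Matrix (Fin (deg r) × Fin p) (Fin (deg r) × Fin p) ℂ) (i j),
      AnalyticOnNhd ℂ (fun u => (c • (E u * X)) i j) D.finiteA := fun c E hE X i j u hu =>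
    analyticAt_const.mul (analyticOnNhd_mul_const hE X i j u hu)
  -- Dividing by γ < 0 would turn J into -J; interchanging the two terms keeps J.
  rcases lt_or_gt_of_ne hγ with h | h
  · refine ⟨J, fun u => (((Real.sqrt (-γ))⁻¹ : ℝ) : ℂ) • (B₁ u * (C * S)),
      fun u => (((Real.sqrt (-γ))⁻¹ : ℝ) : ℂ) • (A₁ u * S), hJ, hJs, han _ hB₁ _, han _ hA₁ _,
      fun z w => ?_⟩
    simp only
    rw [hid', hscale, hscale, hsqrt _ (neg_pos.2 h), ← smul_sub, Matrix.mul_smul, Matrix.smul_mul,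
      ← neg_sub, Matrix.mul_neg, Matrix.neg_mul, smul_neg, ← neg_smul, ← inv_neg]
    simp
  · refine ⟨J, fun u => (((Real.sqrt γ)⁻¹ : ℝ) : ℂ) • (A₁ u * S),
      fun u => (((Real.sqrt γ)⁻¹ : ℝ) : ℂ) • (B₁ u * (C * S)), hJ, hJs, han _ hA₁ _, han _ hB₁ _,
      fun z w => ?_⟩
    simp only
    rw [hid', hscale, hscale, hsqrt _ h, ← smul_sub, Matrix.mul_smul, Matrix.smul_mul]

/-! ### The line and the circle: crossing points, perfectness, and the two cases. -/

theorem exists_mem_connectedComponentIn_eq {U : Set ℂ} {α β : ℂ} (hα : α ∈ U)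
    (hβ : β ∈ connectedComponentIn U α) {f : ℂ → ℝ} (hf : Continuous f) {c : ℝ}
    (hc : c ∈ Set.uIcc (f α) (f β)) : ∃ x ∈ connectedComponentIn U α, f x = c := by
  have h := (isPreconnected_connectedComponentIn (x := α) (F := U)).image f hf.continuousOn
  exact h.ordConnected.uIcc_subset (Set.mem_image_of_mem _ (mem_connectedComponentIn hα))
    (Set.mem_image_of_mem _ hβ) hc

theorem frequently_conj_eq {x : ℂ} (hx : conj x = x) : ∃ᶠ y in 𝓝[≠] x, conj y = y := by
  have h : Tendsto (fun t : ℝ => x + t) (𝓝[≠] 0) (𝓝[≠] x) := by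
    refine tendsto_nhdsWithin_iff.2 ⟨?_, ?_⟩
    · have : Tendsto (fun t : ℝ => x + t) (𝓝 0) (𝓝 (x + (0 : ℝ))) :=
        (by fun_prop : Continuous fun t : ℝ => x + t).tendsto 0
      rw [Complex.ofReal_zero, add_zero] at this
      exact this.mono_left nhdsWithin_le_nhds
    · filter_upwards [self_mem_nhdsWithin] with t ht
      simpa using ht
  exact h.frequently (Eventually.of_forall fun t => by simp [hx]).frequently

theorem frequently_norm_eq_one {x : ℂ} (hx : ‖x‖ = 1) : ∃ᶠ y in 𝓝[≠] x, ‖y‖ = 1 := by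
  have hx0 : x ≠ 0 := by rintro rfl; simp at hx
  have h : Tendsto (fun t : ℝ => x * Complex.exp (t * Complex.I)) (𝓝[>] 0) (𝓝[≠] x) := by
    refine tendsto_nhdsWithin_iff.2 ⟨?_, ?_⟩
    · have : Tendsto (fun t : ℝ => x * Complex.exp (t * Complex.I)) (𝓝 0)
          (𝓝 (x * Complex.exp ((0 : ℝ) * Complex.I))) :=
        (by fun_prop : Continuous fun t : ℝ => x * Complex.exp (t * Complex.I)).tendsto 0
      rw [Complex.ofReal_zero, zero_mul, Complex.exp_zero, mul_one] at this
      exact this.mono_left nhdsWithin_le_nhds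
    · filter_upwards [Ioo_mem_nhdsGT Real.pi_pos] with t ht
      intro hc
      have h1 : Complex.exp (t * Complex.I) = 1 := by
        have : x * Complex.exp (t * Complex.I) = x * 1 := by rw [mul_one]; exact hc
        exact mul_left_cancel₀ hx0 this
      have h2 := congrArg Complex.im h1
      rw [Complex.exp_ofReal_mul_I_im, Complex.one_im] at h2
      exact (Real.sin_pos_of_pos_of_lt_pi ht.1 ht.2).ne' h2
  exact h.frequently (Eventually.of_forall fun t => by
    rw [norm_mul, Complex.norm_exp_ofReal_mul_I, mul_one, hx]).frequently

theorem hasKernelForm_line (hdeg : r.denom.natDegree ≤ r.num.natDegree)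
    (hnum : 0 < r.num.natDegree) (e : Module.Basis (Fin (deg r)) ℂ (stateSpace r))
    (hP : P.IsAnalytic) (h : LineIsometric P) {α : ℂ} {a b : Fin (deg r) → D.domain}
    (hα : α ≠ conj α) (hcomp : conj α ∈ connectedComponentIn D.A α) (ha : IsFibre α a)
    (hb : IsFibre (conj α) b) (hua : IsUnit (gram P a)) (hub : IsUnit (gram P b)) :
    HasKernelForm e P (fun s t => -Complex.I * (s - conj t)) (gram P a) := by
  have hαA := mem_finiteA_of_fibre hdeg hnum ha
  have hβA := mem_finiteA_of_fibre hdeg hnum hb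
  have him : α.im ≠ 0 := fun h0 => hα (Complex.conj_eq_iff_im.2 h0).symm
  have hd0 : ∀ x : ℂ, -Complex.I * (x - conj x) = 0 ↔ conj x = x := fun x => by
    rw [mul_eq_zero, or_iff_right (neg_ne_zero.2 Complex.I_ne_zero), sub_eq_zero, eq_comm]
  -- Im α and Im of its conjugate have opposite signs, so the component crosses the real line.
  obtain ⟨x₀, hx₀, hx₀r⟩ := exists_mem_connectedComponentIn_eq hαA.1 hcomp Complex.continuous_im
    (c := 0) (by
      rw [Complex.conj_im, Set.mem_uIcc]
      rcases le_total α.im 0 with h | h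
      · left; constructor <;> linarith
      · right; constructor <;> linarith)
  refine hasKernelForm_of_identity P hdeg hnum e hP (b := b) ha hua
    (m := fun s => s - conj α) (by fun_prop) (sub_ne_zero.2 hα) (γ := 2 * α.im)
    (mul_ne_zero two_ne_zero him) ?_ ?_ ?_ hx₀ ((hd0 x₀).2 (Complex.conj_eq_iff_im.2 hx₀r))
  · intro s t
    -- The difference of products in the goal is (ᾱ - α)(s - t̄), whence γ = 2 Im α.
    have : ((2 * α.im : ℝ) : ℂ) * -Complex.I = conj α - α := by
      apply Complex.ext <;> simp; ring
    rw [← mul_assoc, this]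
    simp only [map_sub, Complex.conj_conj]
    ring
  · refine smul_reducedKernel P hdeg hnum ha hb hua hub hα one_ne_zero one_ne_zero
      (m' := fun s => s - conj (conj α)) (fun s => (one_mul _).symm) (fun s => by simp)
      (h α ⟨mem_simpleValues_of_fibre hdeg hnum ha, hαA.1⟩ hα)
      (h _ ⟨mem_simpleValues_of_fibre hdeg hnum hb, hβA.1⟩ ?_)
    rw [Complex.conj_conj]
    exact hα.symm
  · intro x hx
    simp only [hd0] at hx ⊢
    exact frequently_conj_eq hx

theorem hasKernelForm_circle (hdeg : r.denom.natDegree ≤ r.num.natDegree)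
    (hnum : 0 < r.num.natDegree) (e : Module.Basis (Fin (deg r)) ℂ (stateSpace r))
    (hP : P.IsAnalytic) (h : CircleIsometric P) {α : ℂ} {a b : Fin (deg r) → D.domain}
    (hα0 : α ≠ 0) (hα : ‖α‖ ≠ 1) (hcomp : (conj α)⁻¹ ∈ connectedComponentIn D.A α)
    (ha : IsFibre α a) (hb : IsFibre (conj α)⁻¹ b) (hua : IsUnit (gram P a))
    (hub : IsUnit (gram P b)) :
    HasKernelForm e P (fun s t => 1 - s * conj t) (gram P a) := by
  have hαA := mem_finiteA_of_fibre hdeg hnum ha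
  have hβA := mem_finiteA_of_fibre hdeg hnum hb
  have hc0 : conj α ≠ 0 := (map_ne_zero _).2 hα0
  have hd0 : ∀ x : ℂ, 1 - x * conj x = 0 ↔ ‖x‖ = 1 := fun x => by
    rw [Complex.mul_conj', sub_eq_zero, eq_comm]
    norm_cast
    exact pow_eq_one_iff_of_nonneg (norm_nonneg x) two_ne_zero
  have hmα : 1 - α * conj α ≠ 0 := fun h0 => hα ((hd0 α).1 h0)
  have hγ : 1 - ‖α‖ ^ 2 ≠ 0 := fun h0 => hmα (by
    rw [Complex.mul_conj']; exact_mod_cast h0)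
  have hnβ : ‖(conj α)⁻¹‖ = ‖α‖⁻¹ := by rw [norm_inv, RCLike.norm_conj]
  have hpos := norm_pos_iff.2 hα0
  obtain ⟨x₀, hx₀, hx₀r⟩ := exists_mem_connectedComponentIn_eq hαA.1 hcomp continuous_norm
    (c := 1) (by
      rw [hnβ, Set.mem_uIcc]
      rcases le_total ‖α‖ 1 with h | h
      · left; exact ⟨h, (one_le_inv₀ hpos).2 h⟩
      · right; exact ⟨inv_le_one_of_one_le₀ h, h⟩)
  have hαβ : α ≠ (conj α)⁻¹ := fun h0 => hmα (by
    rw [← eq_div_iff_mul_eq hc0 |>.1 (h0.trans (one_div _).symm), sub_self])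
  refine hasKernelForm_of_identity P hdeg hnum e hP (b := b) ha hua
    (m := fun s => 1 - s * conj α) (by fun_prop) hmα hγ ?_ ?_ ?_ hx₀ ((hd0 x₀).2 hx₀r)
  · intro s t
    have : ((1 - ‖α‖ ^ 2 : ℝ) : ℂ) = 1 - α * conj α := by
      rw [Complex.mul_conj']; push_cast; rfl
    rw [this]
    simp only [map_sub, map_mul, map_one, Complex.conj_conj]
    ring
  -- With β = 1/ᾱ, the numerator 1 - sᾱ vanishes at β and the one at β vanishes at α; the constants
  -- are κ = -1/ᾱ and κ' = -1/α.
  · have hm : ∀ s : ℂ, s - (conj α)⁻¹ = -(conj α)⁻¹ * (1 - s * conj α) := fun s => by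
      linear_combination -s * inv_mul_cancel₀ hc0
    have hm' : ∀ s : ℂ, 1 - s * conj (conj α)⁻¹ = -α⁻¹ * (s - α) := fun s => by
      rw [map_inv₀, Complex.conj_conj]
      linear_combination -inv_mul_cancel₀ hα0
    refine smul_reducedKernel P hdeg hnum ha hb hua hub hαβ
      (neg_ne_zero.2 (inv_ne_zero hc0)) (neg_ne_zero.2 (inv_ne_zero hα0)) hm hm'
      (h α ⟨mem_simpleValues_of_fibre hdeg hnum ha, hαA.1⟩ hα)
      (h _ ⟨mem_simpleValues_of_fibre hdeg hnum hb, hβA.1⟩ ?_)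
    rw [hnβ]
    exact fun h0 => hα (inv_eq_one.1 h0)
  · intro x hx
    simp only [hd0] at hx ⊢
    exact frequently_norm_eq_one hx

end

end RationalPontryagin

theorem mainTheorem11
    (r : RatFunc ℂ) (hdeg : r.denom.natDegree ≤ r.num.natDegree) (hnum : 0 < r.num.natDegree)
    (e : Module.Basis (Fin (deg r)) ℂ (stateSpace r))
    (D : DiskSystem r) (p : ℕ) (P : RKPontryaginSpace D.domain p) (hP : P.IsAnalytic) :
    -- the line case
    (LineIsometric P →
      ∀ (α : ℂ) (a b : Fin (deg r) → D.domain),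
        α ≠ conj α → conj α ∈ connectedComponentIn D.A α →
        IsFibre α a → IsFibre (conj α) b →
        IsUnit (gram P a) → IsUnit (gram P b) →
        HasKernelForm e P (fun s t => -Complex.I * (s - conj t)) (gram P a)) ∧
    -- the circle case
    (CircleIsometric P →
      ∀ (α : ℂ) (a b : Fin (deg r) → D.domain),
        α ≠ 0 → ‖α‖ ≠ 1 → (conj α)⁻¹ ∈ connectedComponentIn D.A α →
        IsFibre α a → IsFibre (conj α)⁻¹ b →
        IsUnit (gram P a) → IsUnit (gram P b) →
        HasKernelForm e P (fun s t => 1 - s * conj t) (gram P a)) :=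
  ⟨fun h _ _ _ hα hcomp ha hb hua hub =>
    hasKernelForm_line P hdeg hnum e hP h hα hcomp ha hb hua hub,
   fun h _ _ _ hα0 hα hcomp ha hb hua hub =>
    hasKernelForm_circle P hdeg hnum e hP h hα0 hα hcomp ha hb hua hub⟩
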